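/- Let $G=C_2=\{e,\sigma\}$. For $0\le k\le n+1$ let $[n]_k$ be the finite $G$-poset obtained from $\{0<\dots<n\}\times G$ ($G$ discrete, acting on the second factor) by identifying $(i,e)$ with $(i,\sigma)$ for all $i\ge k$. Let $G\Delta$ be the category with objects the $[n]_k$ and with morphisms the isovariant order-preserving maps, i.e. the monotone equivariant maps $f$ with $G_x=G_{f(x)}$ for all $x$. An isovariant simplicial set is a presheaf of sets on $G\Delta$; $\Delta^{n,k}$ is the presheaf represented by $[n]_k$. Faces and horns. For $n\ge 1$ the coface maps omitting $i$ are $d_0^i:[n-1]_k\to[n]_k$ ($k\le i\le n$) and $d_1^i:[n-1]_{k-1}\to[n]_k$ ($0\le i\le k-1$); the codegeneracies repeating $i$ are $s_0^i:[n]_k\to[n-1]_k$ ($k\le i\le n-1$) and $s_1^i:[n]_k\to[n-1]_{k-1}$ ($0\le i<k-1$). Let $\partial_\varepsilon^i\Delta^{n,k}\subseteq\Delta^{n,k}$ be the image of $d_\varepsilon^i$. The boundary $\partial\Delta^{n,k}$ is the union of all these faces (empty for $n=0$), and for $n\ge1$ and $0\le l\le n$ the horn $\Lambda^{n,k}_l$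 is the union of those with $i\ne l$. The horn $\Lambda^{n,k}_l$ is admissible if there are $a\in\{l-1,l\}$ and $\varepsilon\in\{0,1\}$ such that $s_\varepsilon^a$ and $d_\varepsilon^l$ are defined and $d_\varepsilon^l(s_\varepsilon^a(\Delta^{n,k}))=\partial_\varepsilon^l\Delta^{n,k}$. Cylinder. Let $I^{n,k}$ be the presheaf on $G\Delta$ sending $[m]_l$ to the set of isovariant order-preserving maps $[m]_l\to[n]_k\times\{0<1\}$, where $G$ acts trivially on $\{0<1\}$. Let $\mathbb I$ be the left Kan extension of $[n]_k\mapsto I^{n,k}$ along the Yoneda embedding. For $\varepsilon\in\{0,1\}$ let $\partial_\varepsilon^X:X\to\mathbb IX$ be the natural map induced by $\Delta^{n,k}\to I^{n,k}$, $\alpha\mapsto(\alpha(-),\varepsilon)$, and let $\{\varepsilon\}X\subseteq\mathbb IX$ be its image. For a monomorphism $K\to L$, $\mathbb IK\cup\{\varepsilon\}L\subseteq\mathbb IL$ denotes the union of the image of $\mathbb IK$ and of $\{\varepsilon\}L$. Normal monomorphisms. A simplex of an isovariant simplicial set $Y$ is non-degenerate if it is not the pullback of a simplex along a non-invertible epimorphism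 of $G\Delta$. A non-degenerate simplex $y\in Y([m]_l)$ is dominant if no non-identity automorphism of $[m]_l$ fixes it. A simplex is normal if it is the pullback of a dominant simplex along an epimorphism of $G\Delta$. A monomorphism $X\to Y$ is normal if every non-degenerate simplex of $Y$ that does not come from $X$ is normal. A class of maps of isovariant simplicial sets is saturated if it is closed under retracts, pushouts and transfinite compositions. The isovariant anodyne extensions are the members of the smallest saturated class containing the admissible horn inclusions. **Lemma.** Let * $\mathcal A$ be the set of admissible horn inclusions $\Lambda^{n,k}_l\to\Delta^{n,k}$ ($n>0$, $0\le k\le n+1$, $0\le l\le n$); * $\mathcal B$ be the set of inclusions $\mathbb I\,\partial\Delta^{n,k}\cup\{\varepsilon\}\Delta^{n,k}\to\mathbb I\Delta^{n,k}$ ($n\ge0$, $0\le k\le n+1$, $\varepsilon\in\{0,1\}$); * $\mathcal C$ be the class of inclusions $\mathbb IK\cup\{\varepsilon\}L\to\mathbb IL$ ($\varepsilon\in\{0,1\}$, $K\to L$ a normal monomorphism). Let $M_{\mathcal A},M_{\mathcal B},M_{\mathcal C}$ be the smallest saturated classes containing $\mathcal A,\mathcal B,\mathcal C$ respectively. Then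 $M_{\mathcal A}=M_{\mathcal B}=M_{\mathcal C}$, and $M_{\mathcal A}$ is the class of isovariant anodyne extensions. -/

import Mathlib

open CategoryTheory Opposite

namespace Isov

/-! ### Finite posets with an action of the cyclic group of order two, and isovariant maps -/

/-- The cyclic group of order two. -/
abbrev C2 : Type := Multiplicative (ZMod 2)

/-- A finite `C2`-poset: a finite poset with an action of `C2` by order preserving maps. -/
structure GPoset where
  carrier : Type
  [order : PartialOrder carrier]
  [fin : Finite carrier]
  [action : MulAction C2 carrier]
  smul_mono : ∀ g : C2, Monotone fun x : carrier => g • x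

attribute [instance] GPoset.order GPoset.fin GPoset.action

/-- An isovariant order preserving map: monotone, equivariant, and strictly preserving
isotropy groups. -/
@[ext]
structure IsovHom (A B : GPoset) where
  toFun : A.carrier → B.carrier
  mono : Monotone toFun
  map_smul : ∀ (g : C2) (x : A.carrier), toFun (g • x) = g • toFun x
  stab_eq : ∀ x : A.carrier, MulAction.stabilizer C2 x = MulAction.stabilizer C2 (toFun x)

/-- The identity map. -/
def IsovHom.id (A : GPoset) : IsovHom A A where
  toFun x := x
  mono := monotone_id
  map_smul _ _ := rfl
  stab_eq _ := rfl

/-- Composition, in diagrammatic order. -/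
def IsovHom.comp {A B C : GPoset} (f : IsovHom A B) (g : IsovHom B C) : IsovHom A C where
  toFun x := g.toFun (f.toFun x)
  mono := g.mono.comp f.mono
  map_smul c x := by rw [f.map_smul, g.map_smul]
  stab_eq x := (f.stab_eq x).trans (g.stab_eq _)

/-- The category of finite `C2`-posets and isovariant order preserving maps. -/
instance : Category GPoset where
  Hom := IsovHom
  id := IsovHom.id
  comp := IsovHom.comp

/-! ### The posets `[n]_k` -/

/-- The equivalence relation on `[n] × C2` that identifies `(i, e)` with `(i, σ)` for `k ≤ i`. -/
def branchSetoid (n k : ℕ) : Setoid (Fin (n + 1) × C2) where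
  r p q := p.1 = q.1 ∧ (p.2 = q.2 ∨ k ≤ (p.1 : ℕ))
  iseqv :=
    { refl := fun _ => ⟨rfl, Or.inl rfl⟩
      symm := by
        rintro p q ⟨h, h'⟩
        exact ⟨h.symm, h'.elim (fun h' => Or.inl h'.symm) (fun h' => Or.inr (h ▸ h'))⟩
      trans := by
        rintro p q r ⟨h, h'⟩ ⟨h₁, h₁'⟩
        refine ⟨h.trans h₁, ?_⟩
        rcases h' with h' | h'
        · rcases h₁' with h₁' | h₁'
          · exact Or.inl (h'.trans h₁')
          · exact Or.inr (h ▸ h₁')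
        · exact Or.inr h' }

/-- The underlying set of `[n]_k`, the quotient of `[n] × C2` by `branchSetoid n k`. -/
def Branch (n k : ℕ) : Type := Quotient (branchSetoid n k)

/-- The class `[i, g]` in `[n]_k`. -/
def Branch.mk {n : ℕ} (k : ℕ) (i : Fin (n + 1)) (g : C2) : Branch n k :=
  Quotient.mk (branchSetoid n k) (i, g)

lemma Branch.ind {n k : ℕ} {p : Branch n k → Prop} (h : ∀ i g, p (Branch.mk k i g))
    (x : Branch n k) : p x :=
  Quotient.ind (fun a => h a.1 a.2) x

lemma Branch.mk_eq_iff {n k : ℕ} {i j : Fin (n + 1)} {g h : C2} :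
    Branch.mk k i g = Branch.mk k j h ↔ i = j ∧ (g = h ∨ k ≤ (i : ℕ)) :=
  Quotient.eq (r := branchSetoid n k)

/-- The order on `[n]_k` induced by the product order on `[n] × C2`, where `C2` is discrete. -/
instance (n k : ℕ) : LE (Branch n k) where
  le x y := ∃ (i j : Fin (n + 1)) (g : C2), x = Branch.mk k i g ∧ y = Branch.mk k j g ∧ i ≤ j

lemma Branch.mk_le_iff {n k : ℕ} {i j : Fin (n + 1)} {g h : C2} :
    Branch.mk k i g ≤ Branch.mk k j h ↔ i ≤ j ∧ (g = h ∨ k ≤ (j : ℕ)) := by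
  constructor
  · rintro ⟨i', j', g', hi, hj, hij⟩
    rw [Branch.mk_eq_iff] at hi hj
    obtain ⟨rfl, hi⟩ := hi
    obtain ⟨rfl, hj⟩ := hj
    refine ⟨hij, ?_⟩
    rcases hj with hj | hj
    · rcases hi with hi | hi
      · exact Or.inl (hi.trans hj.symm)
      · exact Or.inr (hi.trans hij)
    · exact Or.inr hj
  · rintro ⟨hij, h'⟩
    exact ⟨i, j, g, rfl, Branch.mk_eq_iff.2 ⟨rfl, h'.imp Eq.symm fun h => h⟩, hij⟩

instance (n k : ℕ) : PartialOrder (Branch n k) where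
  le_refl x := by
    induction x using Branch.ind with | _ i g => exact Branch.mk_le_iff.2 ⟨le_rfl, Or.inl rfl⟩
  le_trans x y z := by
    induction x using Branch.ind with | _ i g
    induction y using Branch.ind with | _ j h
    induction z using Branch.ind with | _ m c
    simp only [Branch.mk_le_iff]
    rintro ⟨h₁, h₂⟩ ⟨h₃, h₄⟩
    refine ⟨h₁.trans h₃, ?_⟩
    rcases h₄ with rfl | h₄
    · exact h₂.imp (fun h => h) (fun h => h.trans h₃)
    · exact Or.inr h₄
  le_antisymm x y := by
    induction x using Branch.ind with | _ i g
    induction y using Branch.ind with | _ j h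
    simp only [Branch.mk_le_iff, Branch.mk_eq_iff]
    rintro ⟨h₁, h₂⟩ ⟨h₃, h₄⟩
    obtain rfl := le_antisymm h₁ h₃
    exact ⟨rfl, h₂⟩

instance (n k : ℕ) : Finite (Branch n k) :=
  inferInstanceAs (Finite (Quotient (branchSetoid n k)))

/-- The action `g • [i, h] = [i, g * h]`. -/
instance (n k : ℕ) : MulAction C2 (Branch n k) where
  smul g := Quotient.lift (fun p => Branch.mk k p.1 (g * p.2)) (by
    rintro ⟨i, h⟩ ⟨j, h'⟩ ⟨hij, hh⟩
    exact Branch.mk_eq_iff.2 ⟨hij, hh.imp (fun h => congrArg (g * ·) h) (fun h => h)⟩)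
  one_smul x := by
    induction x using Branch.ind with | _ i g => exact congrArg (Branch.mk k i) (one_mul g)
  mul_smul a b x := by
    induction x using Branch.ind with | _ i g => exact congrArg (Branch.mk k i) (mul_assoc a b g)

lemma Branch.smul_mk {n k : ℕ} (g : C2) (i : Fin (n + 1)) (h : C2) :
    g • Branch.mk k i h = Branch.mk k i (g * h) := rfl

/-- The finite `C2`-poset `[n]_k`. -/
abbrev branchPoset (n k : ℕ) : GPoset where
  carrier := Branch n k
  smul_mono g x y := by
    induction x using Branch.ind with | _ i a
    induction y using Branch.ind with | _ j b
    simp only [Branch.smul_mk, Branch.mk_le_iff]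
    exact fun h => ⟨h.1, h.2.imp (fun h => congrArg (g * ·) h) (fun h => h)⟩

/-! ### The isovariant simplex category -/

/-- The objects `[n]_k`, `0 ≤ k ≤ n + 1`, of the isovariant simplex category. -/
@[ext]
structure GDelta where
  n : ℕ
  k : ℕ
  hk : k ≤ n + 1

/-- The finite `C2`-poset underlying an object of `GDelta`. -/
abbrev GDelta.toGPoset (a : GDelta) : GPoset := branchPoset a.n a.k

/-- `GDelta` as a full subcategory of the category of finite `C2`-posets and isovariant maps. -/
instance : Category GDelta where
  Hom a b := IsovHom a.toGPoset b.toGPoset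
  id a := IsovHom.id a.toGPoset
  comp f g := IsovHom.comp f g

/-- The inclusion of `GDelta` in the category of finite `C2`-posets. -/
def GDelta.incl : GDelta ⥤ GPoset where
  obj := GDelta.toGPoset
  map f := f

/-- The isovariant map `[n]_k ⟶ [m]_l`, `[i, g] ↦ [f i, g]`, induced by a monotone map
`f : [n] → [m]` that preserves and reflects real vertices. -/
def GDelta.ofMonotone {a b : GDelta} (f : Fin (a.n + 1) → Fin (b.n + 1)) (hf : Monotone f)
    (h : ∀ i : Fin (a.n + 1), a.k ≤ (i : ℕ) ↔ b.k ≤ (f i : ℕ)) : a ⟶ b where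
  toFun := Quotient.lift (fun p => Branch.mk b.k (f p.1) p.2) (by
    rintro ⟨i, g⟩ ⟨j, g'⟩ ⟨hij, hg⟩
    exact Branch.mk_eq_iff.2 ⟨congrArg f hij, hg.imp (fun h => h) (h i).1⟩)
  mono := by
    intro x y
    induction x using Branch.ind with | _ i g
    induction y using Branch.ind with | _ j g'
    intro hxy
    obtain ⟨h₁, h₂⟩ := Branch.mk_le_iff.1 hxy
    exact Branch.mk_le_iff.2 ⟨hf h₁, h₂.imp (fun h => h) (h j).1⟩
  map_smul c x := by
    induction x using Branch.ind with | _ i g => rfl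
  stab_eq x := by
    induction x using Branch.ind with | _ i g
    ext c
    rw [MulAction.mem_stabilizer_iff, MulAction.mem_stabilizer_iff]
    change Branch.mk a.k i (c * g) = Branch.mk a.k i g ↔
      Branch.mk b.k (f i) (c * g) = Branch.mk b.k (f i) g
    rw [Branch.mk_eq_iff, Branch.mk_eq_iff, h i]
    simp

/-- The real coface map `d_0^i : [n]_k ⟶ [n+1]_k`, for `k ≤ i ≤ n + 1`. -/
def realCoface (n k : ℕ) (i : Fin (n + 2)) (hi : k ≤ (i : ℕ)) :
    (⟨n, k, by omega⟩ : GDelta) ⟶ ⟨n + 1, k, by omega⟩ :=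
  GDelta.ofMonotone (Fin.succAbove i) (Fin.strictMono_succAbove i).monotone (by
    intro (j : Fin (n + 1))
    change k ≤ (j : ℕ) ↔ k ≤ (i.succAbove j : ℕ)
    simp only [Fin.succAbove, Fin.lt_def, Fin.val_castSucc]
    split_ifs <;> simp <;> omega)

/-- The non-real coface map `d_1^i : [n]_(k-1) ⟶ [n+1]_k`, for `0 ≤ i ≤ k - 1`. -/
def nonrealCoface (n k : ℕ) (hk : k ≤ n + 2) (i : Fin (n + 2)) (hi : (i : ℕ) < k) :
    (⟨n, k - 1, by omega⟩ : GDelta) ⟶ ⟨n + 1, k, hk⟩ :=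
  GDelta.ofMonotone (Fin.succAbove i) (Fin.strictMono_succAbove i).monotone (by
    intro (j : Fin (n + 1))
    change k - 1 ≤ (j : ℕ) ↔ k ≤ (i.succAbove j : ℕ)
    simp only [Fin.succAbove, Fin.lt_def, Fin.val_castSucc]
    split_ifs <;> simp <;> omega)

/-- The real codegeneracy map `s_0^i : [n+1]_k ⟶ [n]_k`, for `k ≤ i ≤ n`. -/
def realCodegeneracy (n k : ℕ) (i : Fin (n + 1)) (hi : k ≤ (i : ℕ)) :
    (⟨n + 1, k, by omega⟩ : GDelta) ⟶ ⟨n, k, by omega⟩ :=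
  GDelta.ofMonotone (Fin.predAbove i) (Fin.predAbove_right_monotone i) (by
    intro (j : Fin (n + 2))
    change k ≤ (j : ℕ) ↔ k ≤ (i.predAbove j : ℕ)
    simp only [Fin.predAbove, Fin.lt_def, Fin.val_castSucc]
    split_ifs <;> simp <;> omega)

/-- The non-real codegeneracy map `s_1^i : [n+1]_k ⟶ [n]_(k-1)`, for `0 ≤ i < k - 1`. -/
def nonrealCodegeneracy (n k : ℕ) (hk : k ≤ n + 2) (i : Fin (n + 1)) (hi : (i : ℕ) + 1 < k) :
    (⟨n + 1, k, hk⟩ : GDelta) ⟶ ⟨n, k - 1, by omega⟩ :=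
  GDelta.ofMonotone (Fin.predAbove i) (Fin.predAbove_right_monotone i) (by
    intro (j : Fin (n + 2))
    change k ≤ (j : ℕ) ↔ k - 1 ≤ (i.predAbove j : ℕ)
    simp only [Fin.predAbove, Fin.lt_def, Fin.val_castSucc]
    split_ifs <;> simp <;> omega)

/-! ### Isovariant simplicial sets, boundaries and horns -/

/-- Isovariant simplicial sets: presheaves of sets on `GDelta`. -/
abbrev IsovSSet : Type 1 := GDeltaᵒᵖ ⥤ Type

/-- The standard simplex `Δ^{n,k}`, the presheaf represented by `[n]_k`. -/
abbrev stdSimplex (a : GDelta) : IsovSSet := yoneda.obj a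

/-- The face `∂^i_0 Δ^{n+1,k}`, the image of the real coface map `d_0^i`. -/
def realFace (n k : ℕ) (hk : k ≤ n + 2) (i : Fin (n + 2)) (hi : k ≤ (i : ℕ)) :
    Subfunctor (stdSimplex ⟨n + 1, k, hk⟩) :=
  Subfunctor.range (yoneda.map (realCoface n k i hi))

/-- The face `∂^i_1 Δ^{n+1,k}`, the image of the non-real coface map `d_1^i`. -/
def nonrealFace (n k : ℕ) (hk : k ≤ n + 2) (i : Fin (n + 2)) (hi : (i : ℕ) < k) :
    Subfunctor (stdSimplex ⟨n + 1, k, hk⟩) :=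
  Subfunctor.range (yoneda.map (nonrealCoface n k hk i hi))

/-- The face of `Δ^{n+1,k}` opposite to the vertex `i`: it is non-real for `i < k` and real
for `k ≤ i`. -/
def face (n k : ℕ) (hk : k ≤ n + 2) (i : Fin (n + 2)) :
    Subfunctor (stdSimplex ⟨n + 1, k, hk⟩) :=
  if hi : (i : ℕ) < k then nonrealFace n k hk i hi else realFace n k hk i (not_lt.1 hi)

/-- The boundary `∂Δ^{n,k}`, the union of all faces; it is empty for `n = 0`. -/
def boundary : (a : GDelta) → Subfunctor (stdSimplex a)
  | ⟨0, _, _⟩ => ⊥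
  | ⟨n + 1, k, hk⟩ => ⨆ i : Fin (n + 2), face n k hk i

/-- The horn `Λ^{n+1,k}_l`, the union of all faces but the `l`-th one. -/
def horn (n k : ℕ) (hk : k ≤ n + 2) (l : Fin (n + 2)) :
    Subfunctor (stdSimplex ⟨n + 1, k, hk⟩) :=
  ⨆ (i : Fin (n + 2)) (_ : i ≠ l), face n k hk i

/-- The horn `Λ^{n+1,k}_l` is admissible: for some `a ∈ {l - 1, l}` and `ε ∈ {0, 1}` such that
`d_ε^l` and `s_ε^a` are defined, `d_ε^l (s_ε^a (Δ^{n+1,k}))` is the face `∂_ε^l Δ^{n+1,k}`. -/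
def Admissible (n k : ℕ) (hk : k ≤ n + 2) (l : Fin (n + 2)) : Prop :=
  ∃ a : Fin (n + 1), ((a : ℕ) = l ∨ (a : ℕ) + 1 = l) ∧
    ((∃ (ha : k ≤ (a : ℕ)) (hl : k ≤ (l : ℕ)),
        Subfunctor.range (yoneda.map (realCodegeneracy n k a ha) ≫
          yoneda.map (realCoface n k l hl)) = realFace n k hk l hl) ∨
      (∃ (ha : (a : ℕ) + 1 < k) (hl : (l : ℕ) < k),
        Subfunctor.range (yoneda.map (nonrealCodegeneracy n k hk a ha) ≫
          yoneda.map (nonrealCoface n k hk l hl)) = nonrealFace n k hk l hl))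

/-! ### The cylinder -/

/-- The thickening `[n]_k × {0 < 1}`, with trivial action on the second factor. -/
def thkObj (a : GDelta) : GPoset where
  carrier := a.toGPoset.carrier × Fin 2
  action :=
    { smul := fun g x => (g • x.1, x.2)
      one_smul := fun x => Prod.ext (one_smul C2 x.1) rfl
      mul_smul := fun g h x => Prod.ext (mul_smul g h x.1) rfl }
  smul_mono g := by
    intro x y h
    exact ⟨a.toGPoset.smul_mono g h.1, h.2⟩

lemma thkObj_stabilizer (a : GDelta) (x : a.toGPoset.carrier) (ε : Fin 2) :
    MulAction.stabilizer C2 (show (thkObj a).carrier from (x, ε)) = MulAction.stabilizer C2 x := by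
  ext g
  rw [MulAction.mem_stabilizer_iff, MulAction.mem_stabilizer_iff]
  exact ⟨fun h => congrArg Prod.fst h, fun h => Prod.ext h rfl⟩

/-- The thickening functor. -/
def thk : GDelta ⥤ GPoset where
  obj := thkObj
  map {a b} f :=
    { toFun := fun x => (IsovHom.toFun f x.1, x.2)
      mono := fun _ _ h => ⟨IsovHom.mono f h.1, h.2⟩
      map_smul := fun g x => Prod.ext (IsovHom.map_smul f g x.1) rfl
      stab_eq := fun x => (thkObj_stabilizer a x.1 x.2).trans
        ((IsovHom.stab_eq f x.1).trans (thkObj_stabilizer b _ x.2).symm) }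

/-- The inclusion `[n]_k ⟶ [n]_k × {0 < 1}`, `x ↦ (x, ε)`, natural in `[n]_k`. -/
def thkEnd (ε : Fin 2) : GDelta.incl ⟶ thk where
  app a :=
    { toFun := fun x => (x, ε)
      mono := fun _ _ h => ⟨h, le_rfl⟩
      map_smul := fun _ _ => rfl
      stab_eq := fun x => (thkObj_stabilizer a x ε).symm }

/-- The functor `[n]_k ↦ I^{n,k}`, where `I^{n,k}` is the restriction to `GDelta` of the presheaf
represented by the thickening of `[n]_k`. -/
def repCyl : GDelta ⥤ IsovSSet :=
  thk ⋙ yoneda ⋙ (Functor.whiskeringLeft _ _ _).obj GDelta.incl.op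

/-- The maps `∂_ε^{n,k} : Δ^{n,k} ⟶ I^{n,k}`, `α ↦ (α(-), ε)`, natural in `[n]_k`. -/
def repEnd (ε : Fin 2) : yoneda ⟶ repCyl where
  app a := { app := fun _ => ↾fun α => GDelta.incl.map α ≫ (thkEnd ε).app a }

/-- The cylinder functor: the left Kan extension of `I` along the Yoneda embedding. -/
noncomputable def cyl : IsovSSet ⥤ IsovSSet :=
  (yoneda : GDelta ⥤ IsovSSet).leftKanExtension repCyl

/-- The canonical map `I^{n,k} ⟶ 𝕀 Δ^{n,k}`. -/
noncomputable def cylUnit : repCyl ⟶ (yoneda : GDelta ⥤ IsovSSet) ⋙ cyl :=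
  (yoneda : GDelta ⥤ IsovSSet).leftKanExtensionUnit repCyl

/-- The natural map `∂_ε : X ⟶ 𝕀 X`: the unique one that restricts along every simplex
`x : Δ^{n,k} ⟶ X` to `Δ^{n,k} ⟶ I^{n,k} ⟶ 𝕀 Δ^{n,k} ⟶ 𝕀 X` (see `cylEnd_fac`). -/
noncomputable def cylEnd (ε : Fin 2) : 𝟭 IsovSSet ⟶ cyl where
  app X :=
    { app := fun a => ↾fun (x : X.obj a) =>
        yonedaEquiv ((repEnd ε).app a.unop ≫ cylUnit.app a.unop ≫ cyl.map (yonedaEquiv.symm x))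
      naturality := by
        intro a b f
        ext x
        change yonedaEquiv ((repEnd ε).app b.unop ≫ cylUnit.app b.unop ≫
            cyl.map (yonedaEquiv.symm (X.map f x))) =
          (cyl.obj X).map f (yonedaEquiv ((repEnd ε).app a.unop ≫ cylUnit.app a.unop ≫
            cyl.map (yonedaEquiv.symm x)))
        have h := (repEnd ε ≫ cylUnit).naturality f.unop
        simp only [NatTrans.comp_app, Functor.comp_map] at h
        rw [yonedaEquiv_symm_map, cyl.map_comp, ← Category.assoc, ← Category.assoc,
          ← h, Category.assoc, Category.assoc]
        exact (yonedaEquiv_naturality _ f.unop).symm }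
  naturality X Y g := by
    ext a x
    change yonedaEquiv ((repEnd ε).app a.unop ≫ cylUnit.app a.unop ≫
        cyl.map (yonedaEquiv.symm (g.app a x))) =
      (cyl.map g).app a (yonedaEquiv ((repEnd ε).app a.unop ≫ cylUnit.app a.unop ≫
        cyl.map (yonedaEquiv.symm x)))
    rw [← yonedaEquiv_comp, Category.assoc, Category.assoc, ← cyl.map_comp]
    congr 4
    apply yonedaEquiv.injective
    rw [yonedaEquiv_comp, Equiv.apply_symm_apply, Equiv.apply_symm_apply]

lemma cylEnd_fac (ε : Fin 2) {X : IsovSSet} {a : GDelta} (x : stdSimplex a ⟶ X) :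
    x ≫ (cylEnd ε).app X = (repEnd ε).app a ≫ cylUnit.app a ≫ cyl.map x := by
  apply yonedaEquiv.injective
  rw [yonedaEquiv_comp]
  change yonedaEquiv ((repEnd ε).app a ≫ cylUnit.app a ≫
    cyl.map (yonedaEquiv.symm (yonedaEquiv x))) = _
  rw [Equiv.symm_apply_apply]

/-- For a morphism `i : K ⟶ L`, the union of the images of `𝕀 K` and of `{ε} L` in `𝕀 L`. -/
noncomputable def cylUnion {K L : IsovSSet} (i : K ⟶ L) (ε : Fin 2) : Subfunctor (cyl.obj L) :=
  Subfunctor.range (cyl.map i) ⊔ Subfunctor.range ((cylEnd ε).app L)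

/-! ### Normal monomorphisms -/

/-- A simplex is non-degenerate if it is not the pullback of a simplex along an epimorphism
of `GDelta` that is not an isomorphism. -/
def Nondegenerate {X : IsovSSet} {a : GDelta} (x : X.obj (op a)) : Prop :=
  ∀ (b : GDelta) (p : a ⟶ b) (u : X.obj (op b)), Epi p → X.map p.op u = x → IsIso p

/-- A simplex is dominant if it is non-degenerate and has no non-trivial automorphism. -/
def Dominant {X : IsovSSet} {a : GDelta} (x : X.obj (op a)) : Prop :=
  Nondegenerate x ∧ ∀ φ : a ≅ a, X.map φ.hom.op x = x → φ = Iso.refl a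

/-- A simplex is normal if it is the pullback of a dominant simplex along an epimorphism. -/
def NormalSimplex {X : IsovSSet} {a : GDelta} (x : X.obj (op a)) : Prop :=
  ∃ (b : GDelta) (p : a ⟶ b) (u : X.obj (op b)), Epi p ∧ Dominant u ∧ X.map p.op u = x

/-- A monomorphism `i : X ⟶ Y` is normal if every non-degenerate simplex of `Y` that does not
come from `X` is normal. -/
def NormalMono {X Y : IsovSSet} (i : X ⟶ Y) : Prop :=
  Mono i ∧ ∀ (a : GDelta) (y : Y.obj (op a)), Nondegenerate y →
    y ∉ Set.range (i.app (op a)) → NormalSimplex y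

/-! ### Saturated classes -/

/-- A class of morphisms is saturated if it is stable under retracts, pushouts and transfinite
compositions. -/
structure Saturated (W : MorphismProperty IsovSSet) : Prop where
  retracts : W.IsStableUnderRetracts
  pushouts : W.IsStableUnderCobaseChange
  transfinite : MorphismProperty.IsStableUnderTransfiniteComposition.{0} W

/-- The saturation of a class of morphisms: the smallest saturated class that contains it. -/
def saturation (S : MorphismProperty IsovSSet) : MorphismProperty IsovSSet :=
  fun _ _ f => ∀ W : MorphismProperty IsovSSet, Saturated W → S ≤ W → W f

/-- The class of admissible horn inclusions `Λ^{n,k}_l ⟶ Δ^{n,k}`, `n > 0`. -/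
inductive classA : MorphismProperty IsovSSet
  | mk (n k : ℕ) (hk : k ≤ n + 2) (l : Fin (n + 2)) (h : Admissible n k hk l) :
    classA (horn n k hk l).ι

/-- The class of inclusions `𝕀 ∂Δ^{n,k} ∪ {ε} Δ^{n,k} ⟶ 𝕀 Δ^{n,k}`. -/
inductive classB : MorphismProperty IsovSSet
  | mk (a : GDelta) (ε : Fin 2) : classB (cylUnion (boundary a).ι ε).ι

/-- The class of inclusions `𝕀 K ∪ {ε} L ⟶ 𝕀 L` for normal monomorphisms `K ⟶ L`. -/
inductive classC : MorphismProperty IsovSSet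
  | mk {K L : IsovSSet} (i : K ⟶ L) (hi : NormalMono i) (ε : Fin 2) :
    classC (cylUnion i ε).ι

/-- Isovariant anodyne extensions: the morphisms in the smallest saturated class that contains
the admissible horn inclusions. -/
def IsovariantAnodyne : MorphismProperty IsovSSet := saturation classA

end Isov

/-! It suffices that a saturated class containing one of the three families contains the others.
Everything rests on two descriptions. A morphism of `GDelta` is a monotone map of indices that
preserves and reflects real vertices, together with a translation by an element of `C2`
(`exists_toFun_mk`); hence factorizations, sections, faces and horns are decided on indices. As `C2`
acts trivially on {0 < 1}, an isovariant map to [n]_k × {0 < 1} is a pair, so the cylinder is X ↦ X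
× J with J the presheaf of monotone maps to {0 < 1} (`cylIso`), and 𝕀K ∪ {ε}L becomes the explicit
`cylProdUnion`.

From A to B: the prism Δ^{n,k} × J is the union of n + 1 shuffles, each a simplex in which one
vertex i is doubled. Attached in the order dictated by ε, each shuffle meets what is already there
in a horn whose missing face is opposite one copy of i (`homOfLe_shuffles_mem`). The other copy is
adjacent and of the same type, real or non-real, which is exactly admissibility (`admissible_iff`).

From B to C: a normal monomorphism is built by repeatedly attaching a missing simplex of least
dimension. It is non-degenerate, hence dominant by normality, and dominance makes its characteristic
map injective off the boundary (`eq_of_map_eq_of_minimal`). So each attachment is a pushout of a map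
in B after taking cylinders, and transfinite composition finishes (`homOfLe_top_mem_of_step`).

From C back to A and B: subobjects of representables are normal (`normalMono_subfunctor_ι`), which
gives B at once, and an admissible horn is a retract of its own cylinder inclusion
(`horn_mem_of_cylProdUnion_mem`). -/

namespace Isov


/-! ### Pushouts, retracts and transfinite unions of subfunctors of presheaves -/

section Presheaf

open Limits

universe w v u

variable {C : Type u} [Category.{v} C]

lemma homOfLe_app_injective {Y : C ⥤ Type w} {A B : Subfunctor Y} (h : A ≤ B) (U : C) :
    Function.Injective ((Subfunctor.homOfLe h).app U) := fun _ _ hxy =>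
  Subtype.ext (congrArg (fun z : B.toFunctor.obj U => (z : Y.obj U)) hxy)

/-- Attaching the image of `p` to a subfunctor `M` is a pushout of `p ⁻¹ M ⟶ X` as soon as `p` is
injective outside of `p ⁻¹ M`. -/
lemma isPushout_sup_range {X Y : C ⥤ Type w} (p : X ⟶ Y) (M N : Subfunctor Y)
    (hN : N = M ⊔ Subfunctor.range p)
    (hp : ∀ (U : C) (x y : X.obj U), p.app U x = p.app U y → p.app U x ∉ M.obj U → x = y) :
    IsPushout (M.fromPreimage p) (M.preimage p).ι
      (Subfunctor.homOfLe (hN ▸ le_sup_left : M ≤ N))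
      (Subfunctor.lift p (hN ▸ le_sup_right : Subfunctor.range p ≤ N)) := by
  subst hN
  have H (U : C) : IsPushout ((M.fromPreimage p).app U) ((M.preimage p).ι.app U)
      ((Subfunctor.homOfLe (le_sup_left : M ≤ M ⊔ Subfunctor.range p)).app U)
      ((Subfunctor.lift p (le_sup_right : Subfunctor.range p ≤ M ⊔ Subfunctor.range p)).app U) := by
    have := (mono_iff_injective _).2
      (homOfLe_app_injective (le_sup_left : M ≤ M ⊔ Subfunctor.range p) U)
    refine Types.isPushout_of_isPullback_of_mono' ?_ ?_ ?_
    · rw [Types.isPullback_iff]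
      refine ⟨rfl, fun x y h => Subtype.ext h.2, fun x y h => ?_⟩
      have h' : x.1 = p.app U y :=
        congrArg (fun z : (M ⊔ Subfunctor.range p).toFunctor.obj U => (z : Y.obj U)) h
      exact ⟨⟨y, show p.app U y ∈ M.obj U from h' ▸ x.2⟩, Subtype.ext h'.symm, rfl⟩
    · refine Set.eq_univ_of_forall ?_
      rintro ⟨y, hy | ⟨x, rfl⟩⟩
      · exact Or.inl ⟨⟨y, hy⟩, rfl⟩
      · exact Or.inr ⟨x, rfl⟩
    · intro x y hx _ hxy
      exact hp U x y (congrArg (fun z : (M ⊔ Subfunctor.range p).toFunctor.obj U =>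
        (z : Y.obj U)) hxy) (fun h => hx ⟨⟨x, h⟩, rfl⟩)
  exact ⟨⟨rfl⟩, ⟨evaluationJointlyReflectsColimits _ fun U =>
    (PushoutCocone.isColimitMapCoconeEquiv _ _).2 (H U).isColimit⟩⟩

/-- A retract of inclusions of subfunctors. -/
def retractArrowSubfunctor {X Y : C ⥤ Type w} (A : Subfunctor X) (B : Subfunctor Y) (s : X ⟶ Y)
    (r : Y ⟶ X) (h : s ≫ r = 𝟙 X) (hs : A ≤ B.preimage s) (hr : B ≤ A.preimage r) :
    RetractArrow A.ι B.ι where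
  i := Arrow.homMk (Subfunctor.lift (A.ι ≫ s)
    (by rw [Subfunctor.range_comp, Subfunctor.range_ι, Subfunctor.image_le_iff]; exact hs)) s rfl
  r := Arrow.homMk (Subfunctor.lift (B.ι ≫ r)
    (by rw [Subfunctor.range_comp, Subfunctor.range_ι, Subfunctor.image_le_iff]; exact hr)) r rfl
  retract := by
    ext : 1
    · rw [← cancel_mono A.ι]
      exact congrArg (A.ι ≫ ·) h
    · exact h

/-- The inclusion of a subfunctor is isomorphic to that of its preimage by an isomorphism. -/
lemma subfunctor_ι_iff (W : MorphismProperty (C ⥤ Type w)) [W.IsStableUnderRetracts]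
    {X Y : C ⥤ Type w} (e : X ≅ Y) (A : Subfunctor X) (B : Subfunctor Y)
    (h : A = B.preimage e.hom) : W A.ι ↔ W B.ι := by
  subst h
  constructor
  · refine W.of_retract (retractArrowSubfunctor _ _ e.inv e.hom e.inv_hom_id ?_ le_rfl)
    rw [← Subfunctor.preimage_comp, e.inv_hom_id, Subfunctor.preimage_id]
  · refine W.of_retract (retractArrowSubfunctor _ _ e.hom e.inv e.hom_inv_id le_rfl ?_)
    rw [← Subfunctor.preimage_comp, e.inv_hom_id, Subfunctor.preimage_id]

lemma range_eq_preimage_of_iso {A B X Y : C ⥤ Type w} (e : A ≅ B) (e' : X ≅ Y) (f : A ⟶ X)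
    (g : B ⟶ Y) (h : f ≫ e'.hom = e.hom ≫ g) :
    Subfunctor.range f = (Subfunctor.range g).preimage e'.hom := by
  have h' : e.inv ≫ f = g ≫ e'.inv := by
    rw [Iso.inv_comp_eq, ← Category.assoc, ← h, Category.assoc, e'.hom_inv_id, Category.comp_id]
  refine le_antisymm ?_ ?_
  · rintro U _ ⟨x, rfl⟩
    exact ⟨e.hom.app U x, (congrArg (fun t => t.app U x) h).symm⟩
  · rintro U x ⟨y, hy⟩
    refine ⟨e.inv.app U y, ?_⟩
    refine (congrArg (fun t => t.app U y) h').trans ?_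
    refine (congrArg (e'.inv.app U) hy).trans ?_
    exact congrArg (fun t => t.app U x) e'.hom_inv_id

/-- The functor attached to a monotone family of subfunctors. -/
@[simps]
def subfunctorFunctor {Y : C ⥤ Type w} {J : Type w} [Preorder J] (G : J → Subfunctor Y)
    (hG : Monotone G) : J ⥤ C ⥤ Type w where
  obj j := (G j).toFunctor
  map f := Subfunctor.homOfLe (hG (leOfHom f))

/-- A cocone in presheaves over a linearly ordered type whose legs are pointwise injective and
jointly surjective is a colimit. -/
noncomputable def isColimitOfInjective {J : Type w} [LinearOrder J] [Nonempty J]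
    {F : J ⥤ C ⥤ Type w} (c : Cocone F)
    (hF : ∀ j U, Function.Injective ((c.ι.app j).app U))
    (hc : ∀ U (x : c.pt.obj U), ∃ j y, (c.ι.app j).app U y = x) : IsColimit c :=
  evaluationJointlyReflectsColimits _ fun U =>
    Types.FilteredColimit.isColimitOf' _ _ (fun x => by
      obtain ⟨j, y, h⟩ := hc U x
      exact ⟨j, y, h.symm⟩) (fun j x y h => ⟨j, 𝟙 j, by
        obtain rfl := hF j U h
        rfl⟩)

/-- Transfinite induction in a complete lattice of subfunctors. -/
lemma homOfLe_top_mem_of_step {Y : C ⥤ Type w} {P : Type w} [CompleteLattice P]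
    (F : P → Subfunctor Y) (hF : Monotone F)
    (hsup : ∀ (ι : Type w) [Nonempty ι] (m : ι → P), F (⨆ i, m i) ≤ ⨆ i, F (m i))
    (W : MorphismProperty (C ⥤ Type w)) [MorphismProperty.IsStableUnderTransfiniteComposition.{w} W]
    (K : P) (step : ∀ M, K ≤ M → M ≠ ⊤ →
      ∃ (M' : P) (h : M < M'), W (Subfunctor.homOfLe (hF h.le))) :
    W (Subfunctor.homOfLe (hF (le_top : K ≤ ⊤))) := by
  classical
  -- The value ⊤ outside the range of `step` is a convenience: it makes `φ` strictly increasing at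
  -- every element other than ⊤, as the iteration lemma requires.
  let φ : P → P := fun M => if h : K ≤ M ∧ M ≠ ⊤ then (step M h.1 h.2).choose else ⊤
  have hφ₁ (M : P) (hM : M ≠ ⊤) : M < φ M := by
    by_cases h : K ≤ M ∧ M ≠ ⊤
    · have := (step M h.1 h.2).choose_spec.choose
      simpa only [φ, dif_pos h] using this
    · simp only [φ, dif_neg h]
      exact lt_top_iff_ne_top.2 hM
  have hφtop : φ ⊤ = ⊤ := by simp [φ]
  have hφ (M : P) : M ≤ φ M := by
    by_cases h : M = ⊤
    · rw [h, hφtop]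
    · exact (hφ₁ M h).le
  have hφW (M : P) (hM : K ≤ M) : W (Subfunctor.homOfLe (hF (hφ M))) := by
    by_cases h : M = ⊤
    · have key : ∀ (N : P) (hN : M ≤ N), M = N → W (Subfunctor.homOfLe (hF hN)) := by
        rintro N hN rfl
        exact W.id_mem _
      exact key _ (hφ M) (by rw [h, hφtop])
    · have key : ∀ (N : P) (hN : M ≤ N), N = (step M hM h).choose →
          W (Subfunctor.homOfLe (hF hN)) := by
        rintro N hN rfl
        exact (step M hM h).choose_spec.choose_spec
      exact key _ (hφ M) (dif_pos ⟨hM, h⟩)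
  -- An iteration indexed by more elements than `P` has cannot be injective, so it must reach ⊤.
  let κ := Order.succ (Cardinal.mk P)
  have : Nonempty κ.ord.ToType := by simp [κ]
  let J := κ.ord.ToType
  let : OrderBot J := WellFoundedLT.toOrderBot _
  let : SuccOrder J := SuccOrder.ofLinearWellFoundedLT _
  let T : J → P := fun j => transfiniteIterate φ j K
  have hT : Monotone T := monotone_transfiniteIterate φ K hφ
  have hbot : T ⊥ = K := transfiniteIterate_bot φ K
  have hKT (j : J) : K ≤ T j := hbot ▸ hT bot_le
  obtain ⟨j₀, hj₀⟩ : ∃ j, T j = ⊤ := by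
    refine top_mem_range_transfiniteIterate φ K hφ₁ hφtop (fun h => ?_)
    have := Cardinal.mk_le_of_injective h
    rw [Cardinal.mk_ord_toType] at this
    exact (Order.lt_succ _).not_ge this
  let G : J → Subfunctor Y := fun j => F (T j)
  have hG : Monotone G := hF.comp hT
  have hcont : (subfunctorFunctor G hG).IsWellOrderContinuous :=
    ⟨fun m hm => ⟨by
      have := hm.nonempty_Iio.to_subtype
      refine isColimitOfInjective _ (fun j U x y h => ?_) (fun U x => ?_)
      · exact homOfLe_app_injective (hG j.2.le) U h
      · have hx : x.1 ∈ (⨆ (j : Set.Iio m), F (T j.1)).obj U := by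
          refine hsup _ (fun j : Set.Iio m => T j.1) U ?_
          rw [← transfiniteIterate_limit φ K m hm]
          exact x.2
        rw [Subfunctor.iSup_obj, Set.mem_iUnion] at hx
        obtain ⟨j, hj⟩ := hx
        exact ⟨j, ⟨x.1, hj⟩, rfl⟩⟩⟩
  let c : Cocone (subfunctorFunctor G hG) :=
    { pt := (F ⊤).toFunctor
      ι := { app := fun j => Subfunctor.homOfLe (hF le_top) } }
  have hc : IsColimit c := isColimitOfInjective _
    (fun j U => homOfLe_app_injective (hF le_top) U)
    (fun U x => ⟨j₀, ⟨x.1, by simpa only [G, hj₀] using x.2⟩, rfl⟩)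
  refine W.transfiniteCompositionsOfShape_le J _ ⟨?_⟩
  refine
    { F := subfunctorFunctor G hG
      isoBot := eqToIso (by simp only [subfunctorFunctor_obj, G, hbot])
      incl := c.ι
      isColimit := hc
      fac := ?_
      map_mem := fun j hj => ?_ }
  · have key : ∀ (M : P) (hM : M = K), eqToHom (show (F K).toFunctor = (F M).toFunctor by rw [hM]) ≫
        Subfunctor.homOfLe (hF (le_top : M ≤ ⊤)) = Subfunctor.homOfLe (hF le_top) := by
      rintro M rfl
      rfl
    exact key _ hbot
  · have key : ∀ (N : P) (hN : T j ≤ N), N = φ (T j) → W (Subfunctor.homOfLe (hF hN)) := by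
      rintro N hN rfl
      exact hφW _ (hKT j)
    exact key _ (hT (Order.le_succ j)) (transfiniteIterate_succ φ K j hj)

end Presheaf


/-! ### Vertices of `[n]_k` and the description of the morphisms of `GDelta` -/

/-- The index of an element of `[n]_k`. -/
def Branch.idx {n k : ℕ} : Branch n k → Fin (n + 1) :=
  Quotient.lift (fun p => p.1) (fun _ _ h => h.1)

@[simp]
lemma Branch.idx_mk {n k : ℕ} (i : Fin (n + 1)) (g : C2) : (Branch.mk k i g).idx = i := rfl

lemma Branch.idx_mono {n k : ℕ} {x y : Branch n k} (h : x ≤ y) : x.idx ≤ y.idx := by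
  induction x using Branch.ind with | _ i g
  induction y using Branch.ind with | _ j g'
  exact (Branch.mk_le_iff.1 h).1

lemma Branch.exists_eq_mk {n k : ℕ} (x : Branch n k) : ∃ g, x = Branch.mk k x.idx g := by
  induction x using Branch.ind with | _ i g
  exact ⟨g, rfl⟩

/-- This turns the isotropy condition into a condition on indices: the generator of `C2` fixes a
vertex exactly when its two labels have been identified. -/
lemma Branch.stabilizer_eq_top_iff {n k : ℕ} (x : Branch n k) :
    MulAction.stabilizer C2 x = ⊤ ↔ k ≤ (x.idx : ℕ) := by
  induction x using Branch.ind with | _ i g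
  simp only [Subgroup.eq_top_iff', MulAction.mem_stabilizer_iff, Branch.smul_mk, Branch.mk_eq_iff,
    true_and, Branch.idx_mk, mul_eq_right]
  constructor
  · intro h
    exact (h (Multiplicative.ofAdd 1)).resolve_left (by decide)
  · exact fun h _ => Or.inr h

/-- The action of a morphism of `GDelta` on indices. -/
def vtx {a b : GDelta} (x : a ⟶ b) (i : Fin (a.n + 1)) : Fin (b.n + 1) :=
  (IsovHom.toFun x (Branch.mk a.k i 1)).idx

lemma idx_toFun {a b : GDelta} (x : a ⟶ b) (p : Branch a.n a.k) :
    (IsovHom.toFun x p).idx = vtx x p.idx := by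
  induction p using Branch.ind with | _ i g
  have h := IsovHom.map_smul x g (Branch.mk a.k i 1)
  rw [Branch.smul_mk, mul_one] at h
  rw [h]
  obtain ⟨c, hc⟩ := (IsovHom.toFun x (Branch.mk a.k i 1)).exists_eq_mk
  rw [hc, Branch.smul_mk, Branch.idx_mk]
  rfl

lemma vtx_mono {a b : GDelta} (x : a ⟶ b) : Monotone (vtx x) := fun _ _ h =>
  Branch.idx_mono (IsovHom.mono x (Branch.mk_le_iff.2 ⟨h, Or.inl rfl⟩))

lemma vtx_real_iff {a b : GDelta} (x : a ⟶ b) (i : Fin (a.n + 1)) :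
    a.k ≤ (i : ℕ) ↔ b.k ≤ (vtx x i : ℕ) := by
  have h := IsovHom.stab_eq x (Branch.mk a.k i 1)
  have h₁ := Branch.stabilizer_eq_top_iff (Branch.mk a.k i 1)
  have h₂ := Branch.stabilizer_eq_top_iff (IsovHom.toFun x (Branch.mk a.k i 1))
  rw [Branch.idx_mk] at h₁
  rw [← h₁, vtx, ← h₂, h]

@[simp]
lemma vtx_id (a : GDelta) (i : Fin (a.n + 1)) : vtx (𝟙 a) i = i := rfl

@[simp]
lemma vtx_comp {a b c : GDelta} (x : a ⟶ b) (y : b ⟶ c) (i : Fin (a.n + 1)) :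
    vtx (x ≫ y) i = vtx y (vtx x i) := idx_toFun y _

@[simp]
lemma vtx_ofMonotone {a b : GDelta} (f : Fin (a.n + 1) → Fin (b.n + 1)) (hf : Monotone f)
    (h : ∀ i : Fin (a.n + 1), a.k ≤ (i : ℕ) ↔ b.k ≤ (f i : ℕ)) (i : Fin (a.n + 1)) :
    vtx (GDelta.ofMonotone f hf h) i = f i := rfl

/-- The translation by an element of `C2`, as an automorphism of `[n]_k`. -/
def twist (a : GDelta) (c : C2) : a ⟶ a where
  toFun x := c • x
  mono := a.toGPoset.smul_mono c
  map_smul g x := by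
    change c • g • x = g • c • x
    rw [smul_smul, smul_smul, mul_comm]
  stab_eq x := by
    induction x using Branch.ind with | _ i g
    ext d
    rw [MulAction.mem_stabilizer_iff, MulAction.mem_stabilizer_iff]
    change Branch.mk a.k i (d * g) = Branch.mk a.k i g ↔
      Branch.mk a.k i (d * (c * g)) = Branch.mk a.k i (c * g)
    simp [Branch.mk_eq_iff]

lemma GDelta.hom_ext {a b : GDelta} {x y : a ⟶ b}
    (h : ∀ p : Branch a.n a.k, IsovHom.toFun x p = IsovHom.toFun y p) : x = y :=
  IsovHom.ext (funext h)

/-- Every morphism of `GDelta` is given by a map of indices and a translation. -/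
lemma exists_toFun_mk {a b : GDelta} (x : a ⟶ b) :
    ∃ c, ∀ i g, IsovHom.toFun x (Branch.mk a.k i g) = Branch.mk b.k (vtx x i) (c * g) := by
  obtain ⟨c, hc⟩ := (IsovHom.toFun x (Branch.mk a.k 0 1)).exists_eq_mk
  refine ⟨c, fun i g => ?_⟩
  have h := IsovHom.map_smul x g (Branch.mk a.k i 1)
  rw [Branch.smul_mk, mul_one] at h
  obtain ⟨d, hd⟩ := (IsovHom.toFun x (Branch.mk a.k i 1)).exists_eq_mk
  -- The translation is read off at vertex 0. Since 0 ≤ i, monotonicity forces the same label at i,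
  -- unless the image is real and labels there do not matter.
  have h₀ := IsovHom.mono x (show Branch.mk a.k 0 1 ≤ Branch.mk a.k i 1 from
    Branch.mk_le_iff.2 ⟨Fin.zero_le i, Or.inl rfl⟩)
  rw [hc, hd, Branch.mk_le_iff] at h₀
  rw [h, hd, Branch.smul_mk, Branch.mk_eq_iff]
  refine ⟨rfl, h₀.2.imp (fun h => ?_) (fun h => h)⟩
  rw [h, mul_comm]

/-- Two elements with the same image have the same image by any morphism that identifies
their indices. -/
lemma toFun_eq_of_toFun_eq {a b c : GDelta} (x : a ⟶ b) (y : a ⟶ c) {q r : Branch a.n a.k}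
    (h : IsovHom.toFun x q = IsovHom.toFun x r) (h' : vtx y q.idx = vtx y r.idx) :
    IsovHom.toFun y q = IsovHom.toFun y r := by
  obtain ⟨d, hd⟩ := exists_toFun_mk x
  obtain ⟨e, he⟩ := exists_toFun_mk y
  induction q using Branch.ind with | _ i g
  induction r using Branch.ind with | _ j g'
  rw [hd, hd, Branch.mk_eq_iff] at h
  rw [he, he, Branch.mk_eq_iff]
  refine ⟨h', h.2.imp (fun h => by rw [mul_left_cancel h]) (fun h => ?_)⟩
  exact (vtx_real_iff y i).1 ((vtx_real_iff x i).2 h)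

/-- A morphism that is injective on indices is a monomorphism. -/
lemma mono_of_vtx_injective {a b : GDelta} (x : a ⟶ b) (hx : Function.Injective (vtx x)) :
    Mono x where
  right_cancellation {c} y z h := GDelta.hom_ext fun p => by
    have h₁ : IsovHom.toFun x (IsovHom.toFun y p) = IsovHom.toFun x (IsovHom.toFun z p) :=
      congrArg (fun w : c ⟶ b => IsovHom.toFun w p) h
    refine toFun_eq_of_toFun_eq x (𝟙 a) h₁ (hx ?_)
    rw [vtx_id, vtx_id, ← idx_toFun, ← idx_toFun, h₁]

/-- A morphism factors through another one as soon as it does so on indices. -/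
lemma exists_factor {a b c : GDelta} (x : a ⟶ c) (f : b ⟶ c) (φ : Fin (a.n + 1) → Fin (b.n + 1))
    (hφ : Monotone φ) (h : ∀ i, vtx f (φ i) = vtx x i) :
    ∃ y : a ⟶ b, y ≫ f = x ∧ vtx y = φ := by
  obtain ⟨d, hd⟩ := exists_toFun_mk x
  obtain ⟨e, he⟩ := exists_toFun_mk f
  -- The factor e⁻¹ * d corrects the translation of `f` to that of `x`.
  refine ⟨GDelta.ofMonotone φ hφ (fun i => ?_) ≫ twist b (e⁻¹ * d), GDelta.hom_ext fun p => ?_, rfl⟩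
  · rw [vtx_real_iff x, vtx_real_iff f, h]
  · induction p using Branch.ind with | _ i g
    rw [hd, ← h]
    change IsovHom.toFun f (Branch.mk b.k (φ i) (e⁻¹ * d * g)) = _
    rw [he, mul_assoc, mul_inv_cancel_left]

/-- A morphism that is surjective on indices has a section through any given element. -/
lemma exists_section {a b : GDelta} (x : a ⟶ b) (hx : Function.Surjective (vtx x))
    (p : Branch a.n a.k) : ∃ s : b ⟶ a, s ≫ x = 𝟙 b ∧
      IsovHom.toFun s (IsovHom.toFun x p) = p := by
  classical
  obtain ⟨t, ht, htp⟩ : ∃ t : Fin (b.n + 1) → Fin (a.n + 1),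
      (∀ j, vtx x (t j) = j) ∧ t (vtx x p.idx) = p.idx := by
    choose t ht using hx
    -- The section is forced through `p`. Any set-theoretic section of a monotone map between chains
    -- is monotone, so this change costs nothing.
    refine ⟨Function.update t (vtx x p.idx) p.idx, fun j => ?_, by simp⟩
    by_cases h : j = vtx x p.idx
    · subst h; simp
    · simp [h, ht]
  have hmono : Monotone t := by
    intro i j hij
    by_contra h
    have h' := vtx_mono x (not_le.1 h).le
    rw [ht, ht] at h'
    obtain rfl := le_antisymm hij h'
    exact h le_rfl
  obtain ⟨s, hs, rfl⟩ := exists_factor (𝟙 b) x t hmono ht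
  refine ⟨s, hs, toFun_eq_of_toFun_eq x (𝟙 a) ?_ ?_⟩
  · exact congrArg (fun w : b ⟶ b => IsovHom.toFun w (IsovHom.toFun x p)) hs
  · rw [vtx_id, vtx_id, idx_toFun, idx_toFun, htp]

lemma epi_of_vtx_surjective {a b : GDelta} (x : a ⟶ b) (hx : Function.Surjective (vtx x)) :
    Epi x := by
  obtain ⟨s, hs, -⟩ := exists_section x hx (Branch.mk a.k 0 1)
  exact epi_of_epi_fac (f := s) hs

/-- A morphism factors through a surjection as soon as it does so on indices. -/
lemma exists_desc {a b c : GDelta} (p : a ⟶ b) (hp : Function.Surjective (vtx p)) (x : a ⟶ c)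
    (h : ∀ i j, vtx p i = vtx p j → vtx x i = vtx x j) : ∃ u : b ⟶ c, p ≫ u = x := by
  obtain ⟨s, hs, -⟩ := exists_section p hp (Branch.mk a.k 0 1)
  refine ⟨s ≫ x, GDelta.hom_ext fun q => ?_⟩
  have h₁ : IsovHom.toFun p (IsovHom.toFun s (IsovHom.toFun p q)) = IsovHom.toFun p q :=
    congrArg (fun w : b ⟶ b => IsovHom.toFun w (IsovHom.toFun p q)) hs
  refine toFun_eq_of_toFun_eq p x h₁ (h _ _ ?_)
  rw [← idx_toFun, ← idx_toFun, h₁]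

lemma isIso_of_vtx_surjective {a b : GDelta} (x : a ⟶ b) (hx : Function.Surjective (vtx x))
    (h : a.n ≤ b.n) : IsIso x := by
  have hn : a.n = b.n := by
    have := Fintype.card_le_of_surjective _ hx
    simp only [Fintype.card_fin] at this
    omega
  have := mono_of_vtx_injective x
    ((Fintype.bijective_iff_surjective_and_card _).2 ⟨hx, by simp [hn]⟩).1
  obtain ⟨s, hs, -⟩ := exists_section x hx (Branch.mk a.k 0 1)
  exact ⟨s, by rw [← cancel_mono x, Category.assoc, hs, Category.comp_id, Category.id_comp], hs⟩

lemma le_of_vtx_surjective {a b : GDelta} (x : a ⟶ b) (hx : Function.Surjective (vtx x)) :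
    b.n ≤ a.n := by
  have := Fintype.card_le_of_surjective _ hx
  simp only [Fintype.card_fin] at this
  omega

/-- If the index j is missed, double the vertex j: the two inclusions of `b`, sending j to one copy
or the other, differ only at j and so agree after `x`. -/
lemma vtx_surjective_of_epi {a b : GDelta} (x : a ⟶ b) [Epi x] :
    Function.Surjective (vtx x) := by
  intro j
  by_contra hj
  let b' : GDelta := ⟨b.n + 1, if (j : ℕ) < b.k then b.k + 1 else b.k, by
    have := b.hk
    split_ifs <;> omega⟩
  let f : b ⟶ b' := GDelta.ofMonotone j.castSucc.succAbove
    (Fin.strictMono_succAbove _).monotone (fun i => by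
      simp only [b', Fin.succAbove, Fin.lt_def, Fin.val_castSucc]
      split_ifs <;> simp <;> omega)
  let g : b ⟶ b' := GDelta.ofMonotone j.succ.succAbove
    (Fin.strictMono_succAbove _).monotone (fun i => by
      simp only [b', Fin.succAbove, Fin.lt_def, Fin.val_castSucc, Fin.val_succ]
      split_ifs <;> simp <;> omega)
  have hfg : f = g := by
    rw [← cancel_epi x]
    refine GDelta.hom_ext fun p => ?_
    induction p using Branch.ind with | _ i c
    obtain ⟨d, hd⟩ := exists_toFun_mk x
    change IsovHom.toFun f (IsovHom.toFun x (Branch.mk a.k i c)) =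
      IsovHom.toFun g (IsovHom.toFun x (Branch.mk a.k i c))
    rw [hd]
    refine congrArg (fun l => Branch.mk b'.k l (d * c)) ?_
    have hij : (vtx x i : ℕ) ≠ j := fun h => hj ⟨i, Fin.ext h⟩
    ext
    simp only [Fin.succAbove, Fin.lt_def, Fin.val_castSucc, Fin.val_succ]
    split_ifs <;> simp <;> omega
  have h := congrArg (fun w : b ⟶ b' => (vtx w j : ℕ)) hfg
  simp [f, g] at h

/-- A degenerate morphism factors through a codegeneracy. -/
lemma exists_epi_factor {a b : GDelta} (x : a ⟶ b) (hx : ¬ Function.Injective (vtx x)) :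
    ∃ (c : GDelta) (p : a ⟶ c) (u : c ⟶ b), Epi p ∧ p ≫ u = x ∧ c.n < a.n := by
  obtain ⟨n, k, hk⟩ := a
  obtain ⟨i, hi₁, hi₂⟩ : ∃ (i : ℕ) (hi : i < n),
      vtx x ⟨i, by change i < n + 1; omega⟩ = vtx x ⟨i + 1, by change i + 1 < n + 1; omega⟩ := by
    by_contra! h
    refine hx (StrictMono.injective (Fin.strictMono_iff_lt_succ.2 fun i => ?_))
    exact lt_of_le_of_ne (vtx_mono x (Fin.castSucc_le_succ i)) (h i i.2)
  have hr₁ := vtx_real_iff x ⟨i, by change i < n + 1; omega⟩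
  have hr₂ := vtx_real_iff x ⟨i + 1, by change i + 1 < n + 1; omega⟩
  rw [← hi₂] at hr₂
  have hr := hr₁.trans hr₂.symm
  simp only at hr
  obtain ⟨n, rfl⟩ : ∃ m, n = m + 1 := ⟨n - 1, by omega⟩
  -- The identified vertices i and i + 1 have the same image, hence the same type; merging them
  -- lowers the number of non-real vertices only if both are non-real.
  let c : GDelta := ⟨n, if i < k then k - 1 else k, by split_ifs <;> omega⟩
  let p : (⟨n + 1, k, hk⟩ : GDelta) ⟶ c := GDelta.ofMonotone
    (Fin.predAbove (⟨i, hi₁⟩ : Fin (n + 1))) (Fin.predAbove_right_monotone _) (by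
    intro (j : Fin (n + 2))
    change k ≤ (j : ℕ) ↔ c.k ≤ (Fin.predAbove (⟨i, hi₁⟩ : Fin (n + 1)) j : ℕ)
    simp only [c, Fin.predAbove, Fin.lt_def, Fin.val_castSucc]
    split_ifs <;> simp <;> omega)
  have hp : Function.Surjective (vtx p) := Fin.predAbove_surjective _
  obtain ⟨u, hu⟩ := exists_desc p hp x (by
    intro (j : Fin (n + 2)) (l : Fin (n + 2)) h
    have h' : ((Fin.predAbove (⟨i, hi₁⟩ : Fin (n + 1)) j : Fin (n + 1)) : ℕ) =
      (Fin.predAbove (⟨i, hi₁⟩ : Fin (n + 1)) l : Fin (n + 1)) := congrArg Fin.val h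
    have h'' : j = l ∨ ((j : ℕ) = i ∧ (l : ℕ) = i + 1) ∨ ((j : ℕ) = i + 1 ∧ (l : ℕ) = i) := by
      rw [Fin.ext_iff]
      simp only [Fin.predAbove, Fin.lt_def, Fin.val_castSucc] at h'
      split_ifs at h' <;> simp at h' <;> omega
    rcases h'' with rfl | ⟨h₁, h₂⟩ | ⟨h₁, h₂⟩
    · rfl
    · exact (congrArg (vtx x) (Fin.ext h₁)).trans
        (hi₂.trans (congrArg (vtx x) (Fin.ext h₂.symm)))
    · exact (congrArg (vtx x) (Fin.ext h₁)).trans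
        (hi₂.symm.trans (congrArg (vtx x) (Fin.ext h₂.symm))))
  exact ⟨c, p, u, epi_of_vtx_surjective p hp, hu, Nat.lt_succ_self n⟩

/-! ### Faces, boundaries and horns in terms of vertices -/

/-- A map that misses i factors through the coface on indices, and `exists_factor` supplies the
translation. Real and non-real faces need no separate treatment from here on. -/
lemma mem_face_iff {n k : ℕ} {hk : k ≤ n + 2} {i : Fin (n + 2)} {a : GDeltaᵒᵖ}
    (x : a.unop ⟶ ⟨n + 1, k, hk⟩) :
    x ∈ (face n k hk i).obj a ↔ ∀ j, vtx x j ≠ i := by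
  have key (c : GDelta) (d : c ⟶ ⟨n + 1, k, hk⟩) (hc : c.n = n)
      (hd : ∀ j, vtx d j = i.succAbove (Fin.cast (by rw [hc]) j)) :
      x ∈ (Subfunctor.range (yoneda.map d)).obj a ↔ ∀ j, vtx x j ≠ i := by
    constructor
    · rintro ⟨y, rfl⟩ j
      change vtx (y ≫ d) j ≠ i
      rw [vtx_comp, hd]
      exact Fin.succAbove_ne _ _
    · intro h
      have h' (j) : ∃ l, i.succAbove l = vtx x j := Fin.exists_succAbove_eq (h j)
      choose φ hφ using h'
      obtain ⟨y, hy, -⟩ := exists_factor x d (fun j => Fin.cast (by rw [hc]) (φ j))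
        (fun j l hjl => by
          have := vtx_mono x hjl
          rw [← hφ, ← hφ] at this
          exact (Fin.strictMono_succAbove i).le_iff_le.1 this)
        (fun j => by rw [hd]; exact hφ j)
      exact ⟨y, hy⟩
  unfold face
  split_ifs with hi
  · exact key _ _ rfl (fun _ => rfl)
  · exact key _ _ rfl (fun _ => rfl)

lemma mem_horn_iff {n k : ℕ} {hk : k ≤ n + 2} {l : Fin (n + 2)} {a : GDeltaᵒᵖ}
    (x : a.unop ⟶ ⟨n + 1, k, hk⟩) :
    x ∈ (horn n k hk l).obj a ↔ ∃ i, i ≠ l ∧ ∀ j, vtx x j ≠ i := by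
  simp only [horn, Subfunctor.iSup_obj, Set.mem_iUnion, exists_prop]
  exact exists_congr fun i => and_congr_right fun _ => mem_face_iff x

lemma mem_boundary_iff {b : GDelta} {a : GDeltaᵒᵖ} (x : a.unop ⟶ b) :
    x ∈ (boundary b).obj a ↔ ¬ Function.Surjective (vtx x) := by
  obtain ⟨_ | n, k, hk⟩ := b
  · have : Subsingleton (Fin ((⟨0, k, hk⟩ : GDelta).n + 1)) :=
      inferInstanceAs (Subsingleton (Fin 1))
    exact ⟨fun h => h.elim, fun h => (h fun i => ⟨0, Subsingleton.elim _ _⟩).elim⟩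
  · change x ∈ (⨆ i : Fin (n + 2), face n k hk i).obj a ↔ _
    simp only [Subfunctor.iSup_obj, Set.mem_iUnion, Function.Surjective, not_forall, not_exists]
    exact exists_congr fun i => mem_face_iff x

/-- A morphism that is not surjective on indices factors through a smaller object. -/
lemma exists_factor_of_not_surjective {a b : GDelta} (x : a ⟶ b)
    (hx : ¬ Function.Surjective (vtx x)) :
    ∃ (c : GDelta) (y : a ⟶ c) (d : c ⟶ b), y ≫ d = x ∧ c.n < b.n := by
  obtain ⟨_ | n, k, hk⟩ := b
  · exact ((mem_boundary_iff (a := op a) x).2 hx).elim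
  · have h := (mem_boundary_iff (a := op a) x).2 hx
    change x ∈ (⨆ i : Fin (n + 2), face n k hk i).obj (op a) at h
    rw [Subfunctor.iSup_obj, Set.mem_iUnion] at h
    obtain ⟨i, h⟩ := h
    unfold face at h
    split_ifs at h
    · obtain ⟨y, hy⟩ := h
      exact ⟨_, y, _, hy, Nat.lt_succ_self n⟩
    · obtain ⟨y, hy⟩ := h
      exact ⟨_, y, _, hy, Nat.lt_succ_self n⟩


/-! ### The cylinder as a product -/

/-- The functor `X ↦ X × J`, where `J` is the presheaf of monotone maps `[n] → {0 < 1}`. -/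
def cylProd : IsovSSet ⥤ IsovSSet where
  obj X :=
    { obj := fun a => X.obj a × (Fin (a.unop.n + 1) →o Fin 2)
      map := fun f => ↾fun x => (X.map f x.1, x.2.comp ⟨vtx f.unop, vtx_mono f.unop⟩)
      map_id := fun a => by
        refine ConcreteCategory.hom_ext _ _ fun x => ?_
        exact Prod.ext (congrArg (fun h => h x.1) (X.map_id a)) rfl
      map_comp := fun f g => by
        refine ConcreteCategory.hom_ext _ _ fun x => ?_
        exact Prod.ext (congrArg (fun h => h x.1) (X.map_comp f g))
          (OrderHom.ext _ _ (funext fun i => congrArg x.2 (vtx_comp g.unop f.unop i))) }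
  map g :=
    { app := fun a => ↾fun x => (g.app a x.1, x.2)
      naturality := fun a b f => by
        refine ConcreteCategory.hom_ext _ _ fun x => ?_
        exact congrArg (fun y => (y, _)) (NatTrans.naturality_apply g f x.1) }

/-- The inclusion `x ↦ (x, ε)` in the product. -/
def cylProdEnd (ε : Fin 2) : 𝟭 IsovSSet ⟶ cylProd where
  app X := { app := fun a => ↾fun x => (x, OrderHom.const _ ε) }

/-- An isovariant map to `[n]_k × {0 < 1}` is an isovariant map to `[n]_k` and a monotone map of
indices to `{0 < 1}`. -/
def thkHomEquiv (a b : GDelta) :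
    IsovHom a.toGPoset (thkObj b) ≃ (a ⟶ b) × (Fin (a.n + 1) →o Fin 2) where
  toFun x :=
    (({ toFun := fun p => (x.toFun p).1
        mono := fun _ _ h => (x.mono h).1
        map_smul := fun g p => congrArg Prod.fst (x.map_smul g p)
        stab_eq := fun p => (x.stab_eq p).trans (thkObj_stabilizer b _ _) } :
          IsovHom a.toGPoset b.toGPoset),
      { toFun := fun i => (x.toFun (Branch.mk a.k i 1)).2
        monotone' := fun _ _ h => (x.mono (Branch.mk_le_iff.2 ⟨h, Or.inl rfl⟩)).2 })
  invFun x :=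
    { toFun := fun p => (IsovHom.toFun x.1 p, x.2 (Branch.idx p))
      mono := fun _ _ h => ⟨IsovHom.mono x.1 h, x.2.monotone (Branch.idx_mono h)⟩
      map_smul := fun g p => Prod.ext (IsovHom.map_smul x.1 g p) (by
        induction p using Branch.ind with | _ i h => rfl)
      stab_eq := fun p => (IsovHom.stab_eq x.1 p).trans (thkObj_stabilizer b _ _).symm }
  left_inv x := by
    refine IsovHom.ext (funext fun p => Prod.ext rfl ?_)
    induction p using Branch.ind with | _ i g
    -- Equivariance with trivial action on {0 < 1}: the level of a vertex depends only on its index.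
    have h := congrArg Prod.snd (x.map_smul g (Branch.mk a.k i 1))
    change (x.toFun (Branch.mk a.k i (g * 1))).2 = (x.toFun (Branch.mk a.k i 1)).2 at h
    rw [mul_one] at h
    exact h.symm
  right_inv x := rfl

/-- The comparison `I^{n,k} ≅ Δ^{n,k} × J`. -/
def repCylIso : repCyl ≅ (yoneda : GDelta ⥤ IsovSSet) ⋙ cylProd :=
  NatIso.ofComponents (fun b => NatIso.ofComponents (fun a => (thkHomEquiv a.unop b).toIso)
    (fun {a c} f => by
      refine ConcreteCategory.hom_ext _ _ fun x => ?_
      refine Prod.ext rfl (OrderHom.ext _ _ (funext fun i => ?_))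
      have h (p : Branch a.unop.n a.unop.k) :
          (IsovHom.toFun x p).2 = ((thkHomEquiv a.unop b) x).2 p.idx :=
        congrArg (fun z : IsovHom a.unop.toGPoset (thkObj b) => (z.toFun p).2)
          ((thkHomEquiv a.unop b).left_inv x).symm
      exact h _)) (fun {b c} f => by
      ext a : 2
      rfl)

open Limits in
/-- The functor `X ↦ X × J` is a left Kan extension of `I` along the Yoneda embedding. -/
lemma isLeftKanExtension_cylProd : cylProd.IsLeftKanExtension repCylIso.hom := by
  refine Functor.LeftExtension.IsPointwiseLeftKanExtension.isLeftKanExtension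
    (E := Functor.LeftExtension.mk _ repCylIso.hom) (fun X => ?_)
  have key (s : Cocone (CostructuredArrow.proj (yoneda : GDelta ⥤ IsovSSet) X ⋙ repCyl))
      (j : CostructuredArrow (yoneda : GDelta ⥤ IsovSSet) X) (a : GDelta) (f : a ⟶ j.left)
      (y : yoneda.obj a ⟶ X) (hy : yoneda.map f ≫ j.hom = y) :
      s.ι.app (CostructuredArrow.mk y) = repCyl.map f ≫ s.ι.app j :=
    (s.w (CostructuredArrow.homMk f hy : CostructuredArrow.mk y ⟶ j)).symm
  -- By Yoneda, the value at (x, χ) must be that of the cocone leg at x on the element (𝟙, χ) of the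
  -- representable cylinder.
  refine
    { desc := fun s =>
        { app := fun a => ↾fun x => (s.ι.app (CostructuredArrow.mk (yonedaEquiv.symm x.1))).app a
            ((thkHomEquiv a.unop a.unop).symm (𝟙 _, x.2))
          naturality := fun a c f => ?_ }
      fac := fun s j => ?_
      uniq := fun s m hm => ?_ }
  · refine ConcreteCategory.hom_ext _ _ fun x => ?_
    have h := key s (CostructuredArrow.mk (yonedaEquiv.symm x.1)) c.unop f.unop
      (yonedaEquiv.symm (X.map f x.1)) (yonedaEquiv_symm_map f x.1).symm
    change (s.ι.app (CostructuredArrow.mk (yonedaEquiv.symm (X.map f x.1)))).app c _ = _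
    rw [h]
    -- Both sides are the pair (f, χ ∘ f), reached by pushing forward along `f` or by restricting
    -- along it.
    have hz : (repCyl.map f.unop).app c ((thkHomEquiv c.unop c.unop).symm
        (𝟙 _, x.2.comp ⟨vtx f.unop, vtx_mono f.unop⟩)) =
        (repCyl.obj a.unop).map f ((thkHomEquiv a.unop a.unop).symm (𝟙 _, x.2)) :=
      IsovHom.ext (funext fun p => Prod.ext rfl (congrArg x.2 (idx_toFun f.unop p).symm))
    refine (congrArg ((s.ι.app (CostructuredArrow.mk (yonedaEquiv.symm x.1))).app c) hz).trans ?_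
    exact NatTrans.naturality_apply (s.ι.app (CostructuredArrow.mk (yonedaEquiv.symm x.1))) f
      ((thkHomEquiv a.unop a.unop).symm (𝟙 _, x.2))
  · ext a z
    obtain ⟨⟨f, χ⟩, rfl⟩ := (thkHomEquiv a.unop j.left).symm.surjective z
    change (s.ι.app (CostructuredArrow.mk (yonedaEquiv.symm (j.hom.app a f)))).app a _ = _
    rw [key s j a.unop f _ (by
      apply yonedaEquiv.injective
      rw [yonedaEquiv_comp, Equiv.apply_symm_apply, yonedaEquiv_yoneda_map])]
    rfl
  · ext a ⟨x, χ⟩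
    have h := congrArg (fun t => t.app a ((thkHomEquiv a.unop a.unop).symm (𝟙 _, χ)))
      (hm (CostructuredArrow.mk (yonedaEquiv.symm x)))
    change m.app a (X.map (𝟙 _) x, χ) = _ at h
    rw [X.map_id] at h
    exact h

instance : cyl.IsLeftKanExtension cylUnit := inferInstanceAs
  (((yoneda : GDelta ⥤ IsovSSet).leftKanExtension repCyl).IsLeftKanExtension
    ((yoneda : GDelta ⥤ IsovSSet).leftKanExtensionUnit repCyl))

/-- The cylinder functor is `X ↦ X × J`. -/
noncomputable def cylIso : cyl ≅ cylProd :=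
  have := isLeftKanExtension_cylProd
  Functor.leftKanExtensionUnique _ cylUnit _ repCylIso.hom

lemma cylUnit_cylIso (a : GDelta) :
    cylUnit.app a ≫ cylIso.hom.app (yoneda.obj a) = repCylIso.hom.app a := by
  have := isLeftKanExtension_cylProd
  exact Functor.descOfIsLeftKanExtension_fac_app (α := cylUnit) _ _ _ a

/-- Both maps can be tested on simplices y : Δ^{n,k} ⟶ X, where `cylEnd_fac` reduces the claim to
the representable cylinder. -/
lemma cylEnd_cylIso (ε : Fin 2) (X : IsovSSet) :
    (cylEnd ε).app X ≫ cylIso.hom.app X = (cylProdEnd ε).app X := by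
  have h {b : GDelta} (y : stdSimplex b ⟶ X) : y ≫ (cylEnd ε).app X ≫ cylIso.hom.app X =
      y ≫ (cylProdEnd ε).app X := by
    refine (congrArg (· ≫ cylIso.hom.app X) (cylEnd_fac ε y)).trans ?_
    rw [Category.assoc, Category.assoc, cylIso.hom.naturality,
      reassoc_of% (cylUnit_cylIso b)]
    apply yonedaEquiv.injective
    rfl
  ext a x
  have h' := congrArg (fun t => t.app a (𝟙 a.unop)) (h (b := a.unop) (yonedaEquiv.symm x))
  change ((cylEnd ε).app X ≫ cylIso.hom.app X).app a (X.map (𝟙 a) x) =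
    ((cylProdEnd ε).app X).app a (X.map (𝟙 a) x) at h'
  rw [X.map_id] at h'
  exact h'

/-- The union of `K × J` and `X × {ε}` in `X × J`. -/
def cylProdUnion {X : IsovSSet} (K : Subfunctor X) (ε : Fin 2) : Subfunctor (cylProd.obj X) where
  obj a := {z | z.1 ∈ K.obj a ∨ z.2 = OrderHom.const _ ε}
  map := by
    rintro a b f ⟨x, χ⟩ (h | h)
    · exact Or.inl (K.map f h)
    · obtain rfl : χ = _ := h
      exact Or.inr rfl

lemma cylUnion_eq_preimage {K X : IsovSSet} (i : K ⟶ X) (ε : Fin 2) :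
    cylUnion i ε = (cylProdUnion (Subfunctor.range i) ε).preimage (cylIso.hom.app X) := by
  have h₁ : Subfunctor.range (cyl.map i) =
      (Subfunctor.range (cylProd.map i)).preimage (cylIso.hom.app X) :=
    range_eq_preimage_of_iso (cylIso.app K) (cylIso.app X) _ _ (cylIso.hom.naturality i)
  have h₂ : Subfunctor.range ((cylEnd ε).app X) =
      (Subfunctor.range ((cylProdEnd ε).app X)).preimage (cylIso.hom.app X) :=
    range_eq_preimage_of_iso (Iso.refl X) (cylIso.app X) _ _ (cylEnd_cylIso ε X)
  rw [cylUnion, h₁, h₂]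
  ext a z
  change (cylIso.hom.app X).app a z ∈ (Subfunctor.range (cylProd.map i)).obj a ∨
    (cylIso.hom.app X).app a z ∈ (Subfunctor.range ((cylProdEnd ε).app X)).obj a ↔
    (cylIso.hom.app X).app a z ∈ (cylProdUnion (Subfunctor.range i) ε).obj a
  generalize (cylIso.hom.app X).app a z = w
  obtain ⟨x, χ⟩ := w
  change _ ↔ x ∈ (Subfunctor.range i).obj a ∨ χ = OrderHom.const _ ε
  refine or_congr ⟨?_, ?_⟩ ⟨?_, ?_⟩
  · rintro ⟨⟨y, χ'⟩, h⟩
    exact ⟨y, congrArg Prod.fst h⟩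
  · rintro ⟨y, rfl⟩
    exact ⟨(y, χ), rfl⟩
  · rintro ⟨y, h⟩
    exact (congrArg Prod.snd h).symm
  · rintro rfl
    exact ⟨x, rfl⟩

lemma cylUnion_ι_mem_iff (W : MorphismProperty IsovSSet) [W.IsStableUnderRetracts]
    {K X : IsovSSet} (i : K ⟶ X) (ε : Fin 2) :
    W (cylUnion i ε).ι ↔ W (cylProdUnion (Subfunctor.range i) ε).ι :=
  subfunctor_ι_iff W (cylIso.app X) _ _ (cylUnion_eq_preimage i ε)


/-! ### Admissible horns are retracts of cylinder inclusions -/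

lemma subfunctor_ι_mem_of_homOfLe_top {W : MorphismProperty IsovSSet}
    [W.RespectsIso] {X : IsovSSet} (A : Subfunctor X)
    (h : W (Subfunctor.homOfLe (le_top : A ≤ ⊤))) : W A.ι :=
  (W.arrow_mk_iso_iff (Arrow.isoMk' (Subfunctor.homOfLe le_top) A.ι (Iso.refl _)
    (asIso (⊤ : Subfunctor X).ι) rfl)).1 h

/-- An isovariant map `[n]_k × {0 < 1} → [n]_k` given by a map of indices. -/
def thkRetract (b : GDelta) (ρ : Fin (b.n + 1) → Fin 2 → Fin (b.n + 1))
    (hρ : ∀ ⦃i j⦄, i ≤ j → ∀ ⦃d e⦄, d ≤ e → ρ i d ≤ ρ j e)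
    (hk : ∀ (i : Fin (b.n + 1)) (e : Fin 2), b.k ≤ (i : ℕ) ↔ b.k ≤ (ρ i e : ℕ)) :
    IsovHom (thkObj b) b.toGPoset where
  toFun q := IsovHom.toFun (GDelta.ofMonotone (a := b) (b := b) (fun i => ρ i q.2)
    (fun _ _ h => hρ h le_rfl) (fun i => hk i q.2)) q.1
  mono := by
    rintro ⟨x, d⟩ ⟨y, e⟩ ⟨h₁, h₂⟩
    induction x using Branch.ind with | _ i g
    induction y using Branch.ind with | _ j g'
    obtain ⟨h₃, h₄⟩ := Branch.mk_le_iff.1 h₁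
    exact Branch.mk_le_iff.2 ⟨hρ h₃ h₂, h₄.imp id (hk j e).1⟩
  map_smul g q := IsovHom.map_smul (GDelta.ofMonotone (a := b) (b := b) (fun i => ρ i q.2)
    (fun _ _ h => hρ h le_rfl) (fun i => hk i q.2)) g q.1
  stab_eq q := (thkObj_stabilizer b q.1 q.2).trans (IsovHom.stab_eq
    (GDelta.ofMonotone (a := b) (b := b) (fun i => ρ i q.2)
      (fun _ _ h => hρ h le_rfl) (fun i => hk i q.2)) q.1)

/-- The map `Δ^{n,k} × J ⟶ Δ^{n,k}` induced by an isovariant map `[n]_k × {0 < 1} → [n]_k`. -/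
def cylProdDesc {b : GDelta} (ρ : IsovHom (thkObj b) b.toGPoset) :
    cylProd.obj (stdSimplex b) ⟶ stdSimplex b :=
  repCylIso.inv.app b ≫
    { app := fun a => ↾fun (z : IsovHom a.unop.toGPoset (thkObj b)) =>
        (IsovHom.comp z ρ : IsovHom a.unop.toGPoset b.toGPoset) }

/-- The retraction Δ × J ⟶ Δ is the projection, except that it moves (m, ε) to l. It is isovariant
because m and l have the same type, and monotone because the move is downwards at the bottom level
or upwards at the top one. On the end ε it misses m, so that end lands in the horn; on the other end
it is the identity. On Λ × J the only new value is l, whose face is not in the horn anyway. -/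
lemma horn_mem_of_cylProdUnion_mem {W : MorphismProperty IsovSSet} [W.IsStableUnderRetracts]
    {n k : ℕ} {hk : k ≤ n + 2} {l m : Fin (n + 2)} {ε : Fin 2}
    (hm : (m : ℕ) = l + 1 ∧ ε = 0 ∨ (m : ℕ) + 1 = l ∧ ε = 1)
    (hlm : k ≤ (m : ℕ) ↔ k ≤ (l : ℕ)) (h : W (cylProdUnion (horn n k hk l) ε).ι) :
    W (horn n k hk l).ι := by
  classical
  let b : GDelta := ⟨n + 1, k, hk⟩
  let ρ : Fin (n + 2) → Fin 2 → Fin (n + 2) := fun i e => if e = ε ∧ i = m then l else i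
  have hρ : ∀ ⦃i j⦄, i ≤ j → ∀ ⦃d e⦄, d ≤ e → ρ i d ≤ ρ j e := by
    intro i j hij d e hde
    simp only [ρ, Fin.le_def, Fin.ext_iff] at *
    split_ifs <;> omega
  have hρk (i : Fin (n + 2)) (e : Fin 2) : k ≤ (i : ℕ) ↔ k ≤ (ρ i e : ℕ) := by
    simp only [ρ]
    split_ifs with h
    · rw [h.2, hlm]
    · rfl
  let r := cylProdDesc (thkRetract b ρ hρ hρk)
  have hr {a : GDeltaᵒᵖ} (x : a.unop ⟶ b) (χ : Fin (a.unop.n + 1) →o Fin 2) (i) :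
      vtx (r.app a (x, χ) : a.unop ⟶ b) i = ρ (vtx x i) (χ i) :=
    idx_toFun (GDelta.ofMonotone (a := b) (b := b) (fun j => ρ j (χ i))
      (fun _ _ h => hρ h le_rfl) (fun j => hρk j (χ i))) (IsovHom.toFun x (Branch.mk _ i 1))
  obtain ⟨ε', hε⟩ : ∃ ε' : Fin 2, ε' ≠ ε := exists_ne ε
  refine W.of_retract (retractArrowSubfunctor _ _ ((cylProdEnd ε').app (stdSimplex b)) r ?_ ?_ ?_) h
  · ext a (x : a.unop ⟶ b)
    refine GDelta.hom_ext fun p => ?_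
    change IsovHom.toFun (GDelta.ofMonotone (a := b) (b := b) (fun j => ρ j ε')
      (fun _ _ h => hρ h le_rfl) (fun j => hρk j ε'))
      (IsovHom.toFun x p) = IsovHom.toFun x p
    generalize IsovHom.toFun x p = q
    induction q using Branch.ind with | _ i g
    change Branch.mk k (ρ i ε') g = Branch.mk k i g
    simp [ρ, hε]
  · exact fun a x hx => Or.inl hx
  · rintro a ⟨x, χ⟩ hx
    change (r.app a (x, χ) : a.unop ⟶ b) ∈ (horn n k hk l).obj a
    rw [mem_horn_iff]
    simp only [hr]
    rcases hx with hx | hx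
    · obtain ⟨i, hi, hx⟩ := (mem_horn_iff x).1 hx
      refine ⟨i, hi, fun j => ?_⟩
      simp only [ρ]
      split_ifs
      · exact hi.symm
      · exact hx j
    · obtain rfl : χ = _ := hx
      have hml : m ≠ l := by rintro rfl; omega
      refine ⟨m, hml, fun j => ?_⟩
      simp only [ρ, OrderHom.const_coe_coe, Function.const_apply, true_and]
      split_ifs with h'
      · exact hml.symm
      · exact h'

/-- Composing with a codegeneracy does not change the image of the coface, since codegeneracies
split. Only the existence of a codegeneracy of the right type merging l with a neighbour m remains.
-/
lemma admissible_iff {n k : ℕ} {hk : k ≤ n + 2} {l : Fin (n + 2)} :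
    Admissible n k hk l ↔ ∃ m : Fin (n + 2), ((m : ℕ) = l + 1 ∨ (m : ℕ) + 1 = l) ∧
      (k ≤ (m : ℕ) ↔ k ≤ (l : ℕ)) := by
  have key {a b c : GDelta} (s : a ⟶ b) (d : b ⟶ c) (hs : Function.Surjective (vtx s)) :
      Subfunctor.range (yoneda.map s ≫ yoneda.map d) = Subfunctor.range (yoneda.map d) := by
    refine le_antisymm (Subfunctor.range_comp_le _ _) ?_
    obtain ⟨t, ht, -⟩ := exists_section s hs (Branch.mk a.k 0 1)
    rintro e _ ⟨x, rfl⟩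
    refine ⟨x ≫ t, ?_⟩
    change ((x ≫ t) ≫ s) ≫ d = x ≫ d
    rw [Category.assoc x, ht, Category.comp_id]
  constructor
  · rintro ⟨a, ha, h⟩
    refine ⟨if (a : ℕ) = l then a.succ else a.castSucc, ?_, ?_⟩
    · split_ifs with h' <;> simp <;> omega
    · rcases h with ⟨h₁, h₂, -⟩ | ⟨h₁, h₂, -⟩ <;> split_ifs with h' <;> simp <;> omega
  · rintro ⟨m, hm, hr⟩
    -- The codegeneracy merging two neighbours is indexed by the smaller one.
    refine ⟨⟨min m l, by omega⟩, by simp only; omega, ?_⟩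
    by_cases hl : k ≤ (l : ℕ)
    · refine Or.inl ⟨by simp only; omega, hl, key _ _ (Fin.predAbove_surjective _)⟩
    · refine Or.inr ⟨by simp only; omega, not_le.1 hl, key _ _ (Fin.predAbove_surjective _)⟩

lemma nondegenerate_stdSimplex {a b : GDelta} (x : a ⟶ b)
    (hx : Nondegenerate (X := stdSimplex b) x) : Function.Injective (vtx x) := by
  by_contra h
  obtain ⟨c, p, u, _, hpu, hc⟩ := exists_epi_factor x h
  have := hx c p u inferInstance hpu
  exact (le_of_vtx_surjective (inv p) (vtx_surjective_of_epi _)).not_gt hc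

/-- The inclusion of a subobject of a representable presheaf is a normal monomorphism. -/
lemma normalMono_subfunctor_ι {b : GDelta} (A : Subfunctor (stdSimplex b)) : NormalMono A.ι := by
  refine ⟨inferInstance, fun a (y : a ⟶ b) hy _ => ⟨a, 𝟙 a, y, inferInstance, ⟨hy, fun φ hφ => ?_⟩,
    Category.id_comp y⟩⟩
  have := mono_of_vtx_injective y (nondegenerate_stdSimplex y hy)
  ext1
  rw [← cancel_mono y]
  exact hφ.trans (Category.id_comp y).symm

lemma classA_le_of_classC_le {W : MorphismProperty IsovSSet} (hW : Saturated W)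
    (h : classC ≤ W) : classA ≤ W := by
  rintro _ _ _ ⟨n, k, hk, l, hl⟩
  have := hW.retracts
  obtain ⟨m, hm, hr⟩ := admissible_iff.1 hl
  have key (ε : Fin 2) : W (cylProdUnion (horn n k hk l) ε).ι := by
    have := (cylUnion_ι_mem_iff W _ ε).1 (h _
      (classC.mk _ (normalMono_subfunctor_ι (horn n k hk l)) ε))
    rwa [Subfunctor.range_ι] at this
  -- A neighbour above l is pushed down at level 0, one below l is pushed up at level 1; this fixes
  -- ε.
  rcases hm with hm | hm
  · exact horn_mem_of_cylProdUnion_mem (Or.inl ⟨hm, rfl⟩) hr (key 0)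
  · exact horn_mem_of_cylProdUnion_mem (Or.inr ⟨hm, rfl⟩) hr (key 1)

lemma classB_le_of_classC_le {W : MorphismProperty IsovSSet} (h : classC ≤ W) : classB ≤ W := by
  rintro _ _ _ ⟨a, ε⟩
  exact h _ (classC.mk _ (normalMono_subfunctor_ι _) ε)


/-! ### Cylinder inclusions of boundaries from admissible horns -/

/-- The object `[n+1]` obtained from `[n]_k` by doubling the vertex `i`. -/
def doubleObj (b : GDelta) (i : Fin (b.n + 1)) : GDelta where
  n := b.n + 1
  k := if (i : ℕ) < b.k then b.k + 1 else b.k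
  hk := by
    have := b.hk
    split_ifs <;> omega

/-- The codegeneracy that identifies the two copies of the vertex `i`. -/
def doubleProj (b : GDelta) (i : Fin (b.n + 1)) : doubleObj b i ⟶ b :=
  GDelta.ofMonotone (a := doubleObj b i) (fun j : Fin (b.n + 2) => i.predAbove j)
    (Fin.predAbove_right_monotone i) (fun (j : Fin (b.n + 2)) => by
      simp only [doubleObj, Fin.predAbove, Fin.lt_def, Fin.val_castSucc]
      split_ifs <;> simp <;> omega)

/-- The simplex of `Δ^{n,k} × J` with vertices `(0, 0), …, (i, 0), (i, 1), …, (n, 1)`. -/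
def shuffle (b : GDelta) (i : Fin (b.n + 1)) :
    stdSimplex (doubleObj b i) ⟶ cylProd.obj (stdSimplex b) :=
  yonedaEquiv.symm ((doubleProj b i,
    { toFun := fun j : Fin (b.n + 2) => if (j : ℕ) ≤ i then 0 else 1
      monotone' := fun j l hjl => by
        have : (j : ℕ) ≤ l := hjl
        dsimp only
        split_ifs <;> omega }) : (doubleObj b i ⟶ b) × (Fin (b.n + 2) →o Fin 2))

lemma val_vtx_doubleProj (b : GDelta) (i : Fin (b.n + 1)) (j : Fin (b.n + 2)) :
    ((vtx (doubleProj b i) j : Fin (b.n + 1)) : ℕ) = if (j : ℕ) ≤ i then (j : ℕ) else j - 1 := by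
  change ((i.predAbove j : Fin (b.n + 1)) : ℕ) = _
  simp only [Fin.predAbove, Fin.lt_def, Fin.val_castSucc]
  split_ifs <;> simp <;> omega

lemma shuffle_app_snd {b : GDelta} {i : Fin (b.n + 1)} {a : GDeltaᵒᵖ}
    (z : a.unop ⟶ doubleObj b i) (t : Fin (a.unop.n + 1)) :
    ((shuffle b i).app a z).2 t = if (vtx z t : ℕ) ≤ i then 0 else 1 := rfl

lemma mem_range_shuffle_iff {b : GDelta} {i : Fin (b.n + 1)} {a : GDeltaᵒᵖ} (x : a.unop ⟶ b)
    (χ : Fin (a.unop.n + 1) →o Fin 2) :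
    ((x, χ) : (a.unop ⟶ b) × _) ∈ (Subfunctor.range (shuffle b i)).obj a ↔
      ∀ t, (χ t = 0 → vtx x t ≤ i) ∧ (χ t = 1 → i ≤ vtx x t) := by
  constructor
  · rintro ⟨z, hz⟩ t
    have h₁ := val_vtx_doubleProj b i (vtx z t)
    have h₂ := shuffle_app_snd z t
    rw [show ((shuffle b i).app a z).2 = χ from congrArg Prod.snd hz] at h₂
    have h₃ : z ≫ doubleProj b i = x := congrArg Prod.fst hz
    rw [← h₃, vtx_comp, h₂]
    simp only [Fin.le_def, h₁]
    split_ifs <;> simp <;> omega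
  · intro h
    have hval (t) : (χ t = 0 ∧ (vtx x t : ℕ) ≤ i) ∨ (χ t = 1 ∧ (i : ℕ) ≤ vtx x t) := by
      have := h t
      simp only [Fin.le_def] at this
      omega
    -- In the doubled simplex, (j, 0) sits at index j and (j, 1) at index j + 1.
    let φ : Fin (a.unop.n + 1) → Fin (b.n + 2) := fun t =>
      if χ t = 0 then (vtx x t).castSucc else (vtx x t).succ
    have hφ (t) : (φ t : ℕ) = if χ t = 0 then (vtx x t : ℕ) else vtx x t + 1 := by
      simp only [φ]
      split_ifs <;> simp
    obtain ⟨z, hz, hzφ⟩ := exists_factor x (doubleProj b i) φ (fun t u htu => by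
      have h₁ : (vtx x t : ℕ) ≤ vtx x u := vtx_mono x htu
      have h₂ := χ.monotone htu
      change (φ t : ℕ) ≤ φ u
      rw [hφ, hφ]
      split_ifs <;> omega) (fun t => by
      rw [Fin.ext_iff, val_vtx_doubleProj, hφ]
      have := hval t
      split_ifs <;> omega)
    refine ⟨z, Prod.ext hz (OrderHom.ext _ _ (funext fun t => ?_))⟩
    change _ = χ t
    rw [shuffle_app_snd, hzφ, hφ]
    have := hval t
    split_ifs <;> omega

/-- The projection loses only the distinction between the two copies of i, and these lie on
different levels. -/
lemma shuffle_app_injective {b : GDelta} {i : Fin (b.n + 1)} {a : GDeltaᵒᵖ}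
    (z w : a.unop ⟶ doubleObj b i) (h : (shuffle b i).app a z = (shuffle b i).app a w) :
    z = w := by
  have h₁ : z ≫ doubleProj b i = w ≫ doubleProj b i := congrArg Prod.fst h
  refine GDelta.hom_ext fun p => ?_
  have h₂ : IsovHom.toFun (doubleProj b i) (IsovHom.toFun z p) =
      IsovHom.toFun (doubleProj b i) (IsovHom.toFun w p) :=
    congrArg (fun t : a.unop ⟶ b => IsovHom.toFun t p) h₁
  refine toFun_eq_of_toFun_eq (doubleProj b i) (𝟙 _) h₂ ?_
  rw [vtx_id, vtx_id, idx_toFun, idx_toFun]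
  have h₃ := congrArg (fun q : Branch b.n b.k => (q.idx : ℕ)) h₂
  simp only [idx_toFun] at h₃
  have h₄ := congrArg (fun q : (a.unop ⟶ b) × (Fin (a.unop.n + 1) →o Fin 2) => q.2 p.idx) h
  simp only [shuffle_app_snd] at h₄
  have h₅ := val_vtx_doubleProj b i (vtx z p.idx)
  have h₆ := val_vtx_doubleProj b i (vtx w p.idx)
  rw [Fin.ext_iff]
  split_ifs at h₄ h₅ h₆ <;> omega

/-- The union of the cylinder inclusion of the boundary and of some of the shuffles. -/
def shuffles (b : GDelta) (ε : Fin 2) (S : Set (Fin (b.n + 1))) :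
    Subfunctor (cylProd.obj (stdSimplex b)) :=
  cylProdUnion (boundary b) ε ⊔ ⨆ (i) (_ : i ∈ S), Subfunctor.range (shuffle b i)

lemma shuffles_mono (b : GDelta) (ε : Fin 2) : Monotone (shuffles b ε) := fun S T h => by
  unfold shuffles
  exact sup_le_sup_left (biSup_mono h) _

lemma shuffles_empty (b : GDelta) (ε : Fin 2) :
    shuffles b ε ∅ = cylProdUnion (boundary b) ε := by
  simp [shuffles]

lemma shuffles_insert (b : GDelta) (ε : Fin 2) (S : Set (Fin (b.n + 1))) (i : Fin (b.n + 1)) :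
    shuffles b ε (insert i S) = shuffles b ε S ⊔ Subfunctor.range (shuffle b i) := by
  simp only [shuffles, iSup_insert]
  rw [sup_assoc, sup_comm (Subfunctor.range _)]

lemma mem_shuffles_iff {b : GDelta} {ε : Fin 2} {S : Set (Fin (b.n + 1))} {a : GDeltaᵒᵖ}
    (x : a.unop ⟶ b) (χ : Fin (a.unop.n + 1) →o Fin 2) :
    ((x, χ) : (a.unop ⟶ b) × _) ∈ (shuffles b ε S).obj a ↔
      ((∃ j, ∀ t, vtx x t ≠ j) ∨ ∀ t, χ t = ε) ∨
        ∃ i ∈ S, ∀ t, (χ t = 0 → vtx x t ≤ i) ∧ (χ t = 1 → i ≤ vtx x t) := by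
  have h₁ : x ∈ (boundary b).obj a ↔ ∃ j, ∀ t, vtx x t ≠ j := by
    rw [mem_boundary_iff]
    simp only [Function.Surjective, not_forall, not_exists]
  have h₂ : χ = OrderHom.const _ ε ↔ ∀ t, χ t = ε :=
    ⟨fun h t => by rw [h]; rfl, fun h => OrderHom.ext _ _ (funext h)⟩
  refine or_congr (or_congr h₁ h₂) ?_
  simp only [Subfunctor.iSup_obj]
  exact Set.mem_iUnion₂.trans (exists_congr fun i => exists_prop.trans
    (and_congr_right fun _ => mem_range_shuffle_iff x χ))

lemma shuffles_univ (b : GDelta) (ε : Fin 2) : shuffles b ε Set.univ = ⊤ := by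
  rw [← top_le_iff]
  rintro a ⟨(x : a.unop ⟶ b), χ⟩ -
  refine (mem_shuffles_iff x χ).2 (Or.inr ?_)
  by_cases h : ∃ t, χ t = 1
  · obtain ⟨t, ht, hmin⟩ := exists_minimal_of_wellFoundedLT (fun t => χ t = 1) h
    have hlt (u) (hu : χ u = 0) : u ≤ t := by
      by_contra h'
      have := χ.monotone (not_le.1 h').le
      rw [hu, ht] at this
      exact absurd this (by decide)
    exact ⟨vtx x t, trivial, fun u => ⟨fun hu => vtx_mono x (hlt u hu),
      fun hu => vtx_mono x (le_of_not_gt fun h' => (hmin hu h'.le).not_gt h')⟩⟩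
  · exact ⟨Fin.last _, trivial, fun t => ⟨fun _ => Fin.le_last _, fun ht => (h ⟨t, ht⟩).elim⟩⟩

/-- Here `v` is the index map into the doubled simplex, `w` its projection and `χ` its level.
Missing a vertex other than the two copies of i means projecting into the boundary. Missing the copy
other than l means lying in the adjacent, already attached shuffle or, if there is none, in the end
ε. Only the face opposite l is new. -/
lemma mem_shuffles_iff_mem_horn {α : Type*} {n : ℕ} {i : Fin (n + 1)} {l : Fin (n + 2)} {ε : Fin 2}
    {S : Set (Fin (n + 1))} (hl : (l : ℕ) = if ε = 0 then (i : ℕ) else i + 1)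
    (hS : ε = 0 ∧ S = Set.Ioi i ∨ ε = 1 ∧ S = Set.Iio i) (v : α → Fin (n + 2))
    (w : α → Fin (n + 1)) (χ : α → Fin 2)
    (hw : ∀ t, (w t : ℕ) = if (v t : ℕ) ≤ i then (v t : ℕ) else v t - 1)
    (hχ : ∀ t, χ t = if (v t : ℕ) ≤ i then 0 else 1) :
    (((∃ j, ∀ t, w t ≠ j) ∨ ∀ t, χ t = ε) ∨
        ∃ j ∈ S, ∀ t, (χ t = 0 → w t ≤ j) ∧ (χ t = 1 → j ≤ w t)) ↔
      ∃ m, m ≠ l ∧ ∀ t, v t ≠ m := by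
  simp only [ne_eq, Fin.ext_iff (n := n + 1), Fin.ext_iff (n := n + 2), Fin.le_def, hw, hχ]
  rcases hS with ⟨rfl, rfl⟩ | ⟨rfl, rfl⟩
  · simp only [if_true] at hl
    constructor
    · rintro ((⟨j, hj⟩ | h) | ⟨j, hj, h⟩)
      · refine ⟨if j < i then j.castSucc else j.succ, ?_, fun t => ?_⟩
        · simp only [Fin.lt_def]
          split_ifs <;> simp <;> omega
        · have := hj t
          simp only [Fin.lt_def]
          split_ifs at * <;> simp <;> omega
      · refine ⟨i.succ, by simp; omega, fun t => ?_⟩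
        have := h t
        split_ifs at this
        · simp; omega
        · simp at this
      · rw [Set.mem_Ioi, Fin.lt_def] at hj
        refine ⟨i.succ, by simp; omega, fun t => ?_⟩
        have := h t
        split_ifs at this
        · simp; omega
        · simp at this ⊢; omega
    · rintro ⟨m, hm, h⟩
      rcases lt_trichotomy (m : ℕ) (i + 1) with hmi | hmi | hmi
      · refine Or.inl (Or.inl ⟨⟨m, by omega⟩, fun t => ?_⟩)
        have := h t
        split_ifs <;> simp <;> omega
      -- The upper copy of i is missed. For i = n nothing remains on level 1; otherwise the simplex
      -- also belongs to the shuffle that breaks at i + 1.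
      · by_cases hin : (i : ℕ) = n
        · refine Or.inl (Or.inr fun t => if_pos ?_)
          have := h t
          omega
        · refine Or.inr ⟨⟨i + 1, by omega⟩, Fin.lt_def.2 (Nat.lt_succ_self i), fun t => ?_⟩
          have := h t
          split_ifs <;> simp <;> omega
      · refine Or.inl (Or.inl ⟨⟨m - 1, by omega⟩, fun t => ?_⟩)
        have := h t
        split_ifs <;> simp <;> omega
  · simp only [one_ne_zero, if_false] at hl
    constructor
    · rintro ((⟨j, hj⟩ | h) | ⟨j, hj, h⟩)
      · refine ⟨if j ≤ i then j.castSucc else j.succ, ?_, fun t => ?_⟩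
        · simp only [Fin.le_def]
          split_ifs <;> simp <;> omega
        · have := hj t
          simp only [Fin.le_def]
          split_ifs at * <;> simp <;> omega
      · refine ⟨i.castSucc, by simp; omega, fun t => ?_⟩
        have := h t
        split_ifs at this
        · simp at this
        · simp; omega
      · rw [Set.mem_Iio, Fin.lt_def] at hj
        refine ⟨i.castSucc, by simp; omega, fun t => ?_⟩
        have := h t
        split_ifs at this
        · simp at this ⊢; omega
        · simp; omega
    · rintro ⟨m, hm, h⟩
      rcases lt_trichotomy (m : ℕ) i with hmi | hmi | hmi
      · refine Or.inl (Or.inl ⟨⟨m, by omega⟩, fun t => ?_⟩)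
        have := h t
        split_ifs <;> simp <;> omega
      -- The lower copy of i is missed. For i = 0 nothing remains on level 0; otherwise the simplex
      -- also belongs to the shuffle that breaks at i - 1.
      · by_cases hin : (i : ℕ) = 0
        · refine Or.inl (Or.inr fun t => if_neg ?_)
          have := h t
          omega
        · refine Or.inr ⟨⟨i - 1, by omega⟩, Fin.lt_def.2 (by simp only; omega), fun t => ?_⟩
          have := h t
          split_ifs <;> simp <;> omega
      · refine Or.inl (Or.inl ⟨⟨m - 1, by omega⟩, fun t => ?_⟩)
        have := h t
        split_ifs <;> simp <;> omega

/-- Attaching a shuffle whose preimage is an admissible horn. -/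
lemma homOfLe_shuffles_mem {W : MorphismProperty IsovSSet} [W.IsStableUnderCobaseChange]
    (h : classA ≤ W) (b : GDelta) (ε : Fin 2) (i : Fin (b.n + 1)) (S T : Set (Fin (b.n + 1)))
    (hST : S ≤ T) (hT : T = insert i S)
    (hS : ε = 0 ∧ S = Set.Ioi i ∨ ε = 1 ∧ S = Set.Iio i) :
    W (Subfunctor.homOfLe (shuffles_mono b ε hST)) := by
  let l : Fin (b.n + 2) := if ε = 0 then i.castSucc else i.succ
  have hl : (l : ℕ) = if ε = 0 then (i : ℕ) else i + 1 := by
    simp only [l]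
    split_ifs <;> simp
  have hpre : (shuffles b ε S).preimage (shuffle b i) =
      horn b.n (doubleObj b i).k (doubleObj b i).hk l := by
    ext a (z : a.unop ⟶ doubleObj b i)
    refine Iff.trans (mem_shuffles_iff _ _) (Iff.trans ?_ (mem_horn_iff z).symm)
    exact mem_shuffles_iff_mem_horn hl hS (vtx z) _ _ (fun t =>
      (congrArg Fin.val (vtx_comp z (doubleProj b i) t)).trans
        (val_vtx_doubleProj b i (vtx z t))) (shuffle_app_snd z)
  refine W.of_isPushout (isPushout_sup_range (shuffle b i) _ _ (hT ▸ shuffles_insert b ε S i)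
    (fun a z w h _ => shuffle_app_injective z w h)) ?_
  rw [hpre]
  -- The admissibility witness is the other copy of i, which has the same type as l.
  refine h _ (classA.mk _ _ _ _ (admissible_iff.2
    ⟨if ε = 0 then i.succ else i.castSucc, ?_, ?_⟩))
  · rw [hl]
    split_ifs <;> simp
  · rw [hl]
    simp only [doubleObj]
    split_ifs <;> simp <;> omega

lemma classB_le_of_classA_le {W : MorphismProperty IsovSSet} (hW : Saturated W)
    (h : classA ≤ W) : classB ≤ W := by
  have := hW.retracts
  have := hW.pushouts
  have := hW.transfinite
  have chain (b : GDelta) (ε : Fin 2) (S : ℕ → Set (Fin (b.n + 1))) (hS : Monotone S)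
      (N : ℕ) (hstep : ∀ j < N, W (Subfunctor.homOfLe (shuffles_mono b ε (hS j.le_succ)))) :
      W (Subfunctor.homOfLe (shuffles_mono b ε (hS N.zero_le))) := by
    induction N with
    | zero => exact W.id_mem _
    | succ N ih =>
      exact W.comp_mem _ _ (ih fun j hj => hstep j (hj.trans N.lt_succ_self))
        (hstep N N.lt_succ_self)
  have key (b : GDelta) (ε : Fin 2) (S : ℕ → Set (Fin (b.n + 1))) (hS : Monotone S)
      (h₀ : S 0 = ∅) (h₁ : S (b.n + 1) = Set.univ)
      (hstep : ∀ j < b.n + 1, W (Subfunctor.homOfLe (shuffles_mono b ε (hS j.le_succ)))) :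
      W (cylUnion (boundary b).ι ε).ι := by
    refine (cylUnion_ι_mem_iff W _ ε).2 ?_
    rw [Subfunctor.range_ι, ← shuffles_empty, ← h₀]
    refine subfunctor_ι_mem_of_homOfLe_top _ ?_
    have key := chain b ε S hS _ hstep
    have htop : shuffles b ε (S (b.n + 1)) = ⊤ := by rw [h₁, shuffles_univ]
    revert key
    generalize_proofs h₁ h₂
    revert h₁
    rw [htop]
    exact fun _ h => h
  rintro _ _ _ ⟨b, ε⟩
  obtain rfl | rfl : ε = 0 ∨ ε = 1 := by omega
  -- For ε = 0 the shuffles are attached from i = n downwards: the first one has its face opposite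
  -- (n, 1) in the end 0. For ε = 1 the order is reversed.
  · have hmono : Monotone fun j => {i : Fin (b.n + 1) | b.n + 1 ≤ i + j} :=
      fun j l hjl i (hi : b.n + 1 ≤ i + j) => show b.n + 1 ≤ i + l by omega
    refine key b 0 _ hmono
      (Set.eq_empty_of_forall_notMem fun i (hi : b.n + 1 ≤ i + 0) => by omega)
      (Set.eq_univ_of_forall fun i => show b.n + 1 ≤ i + (b.n + 1) by omega) (fun j hj => ?_)
    refine homOfLe_shuffles_mem h b 0 ⟨b.n - j, by omega⟩ _ _ (hmono j.le_succ) ?_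
      (Or.inl ⟨rfl, ?_⟩)
    · ext i
      simp only [Set.mem_ofPred_eq, Set.mem_insert_iff, Fin.ext_iff]
      omega
    · ext i
      simp only [Set.mem_ofPred_eq, Set.mem_Ioi, Fin.lt_def]
      omega
  · have hmono : Monotone fun j => {i : Fin (b.n + 1) | (i : ℕ) < j} :=
      fun j l hjl i (hi : (i : ℕ) < j) => show (i : ℕ) < l by omega
    refine key b 1 _ hmono
      (Set.eq_empty_of_forall_notMem fun i (hi : (i : ℕ) < 0) => by omega)
      (Set.eq_univ_of_forall fun i => show (i : ℕ) < b.n + 1 by omega) (fun j hj => ?_)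
    refine homOfLe_shuffles_mem h b 1 ⟨j, hj⟩ _ _ (hmono j.le_succ) ?_ (Or.inr ⟨rfl, ?_⟩)
    · ext i
      simp only [Set.mem_ofPred_eq, Set.mem_insert_iff, Fin.ext_iff]
      omega
    · ext i
      simp only [Set.mem_ofPred_eq, Set.mem_Iio, Fin.lt_def]


/-! ### Cylinder inclusions of normal monomorphisms from those of boundaries -/

lemma cylProdUnion_mono {X : IsovSSet} (ε : Fin 2) :
    Monotone fun K : Subfunctor X => cylProdUnion K ε :=
  fun _ _ h _ _ hx => hx.imp (fun hx => h _ hx) id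

lemma exists_minimal_simplex {L : IsovSSet} {M : Subfunctor L} (hM : M ≠ ⊤) :
    ∃ (a : GDelta) (y : L.obj (op a)), y ∉ M.obj (op a) ∧
      ∀ (c : GDelta) (u : L.obj (op c)), c.n < a.n → u ∈ M.obj (op c) := by
  classical
  have h : ∃ (m : ℕ) (a : GDelta) (y : L.obj (op a)), a.n = m ∧ y ∉ M.obj (op a) := by
    by_contra! h
    exact hM (top_le_iff.1 fun a y _ => h _ a.unop y rfl)
  obtain ⟨a, y, ha, hy⟩ := Nat.find_spec h
  refine ⟨a, y, hy, fun c u hc => ?_⟩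
  by_contra hu
  exact Nat.find_min h (ha ▸ hc) ⟨c, u, rfl, hu⟩

/-- Every normal non-degenerate simplex is dominant. -/
lemma NormalSimplex.dominant {X : IsovSSet} {a : GDelta} {x : X.obj (op a)}
    (hx : NormalSimplex x) (hx' : Nondegenerate x) : Dominant x := by
  obtain ⟨b, p, u, hp, hu, rfl⟩ := hx
  have := hx' b p u hp rfl
  refine ⟨hx', fun φ hφ => ?_⟩
  -- Non-degeneracy makes `p` invertible, so an automorphism fixing the simplex is conjugated to one
  -- fixing `u`.
  have h := hu.2 ((asIso p).symm ≪≫ φ ≪≫ asIso p) (by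
    have h₁ := congrArg (X.map (inv p).op) hφ
    simp only [← Functor.map_comp_apply, ← op_comp] at h₁
    simpa using h₁)
  have h' := congrArg (fun ψ : b ≅ b => p ≫ ψ.hom ≫ inv p) h
  ext1
  simpa using h'

/-! ### Attaching a missing simplex of least dimension -/

section Cell

variable {L : IsovSSet} {M : Subfunctor L} {a : GDelta} {y : L.obj (op a)}
  (hy : y ∉ M.obj (op a))
  (hmin : ∀ (c : GDelta) (u : L.obj (op c)), c.n < a.n → u ∈ M.obj (op c))

include hy hmin in
lemma nondegenerate_of_minimal : Nondegenerate y := by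
  intro b p u _ h
  have hu : u ∉ M.obj (op b) := fun hu => hy (h ▸ M.map p.op hu)
  exact isIso_of_vtx_surjective p (vtx_surjective_of_epi p)
    (not_lt.1 fun h => hu (hmin b u h))

-- A surjective `f` has a section, along which membership in `M` would pass back to `y`; any other
-- `f` factors through an object of smaller dimension, where all simplices are in `M`.
include hy hmin in
lemma map_mem_iff_of_minimal {c : GDelta} (f : c ⟶ a) :
    L.map f.op y ∈ M.obj (op c) ↔ ¬ Function.Surjective (vtx f) := by
  constructor
  · intro h hf
    obtain ⟨s, hs, -⟩ := exists_section f hf (Branch.mk c.k 0 1)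
    refine hy ?_
    have h' : L.map s.op (L.map f.op y) ∈ M.obj (op a) := M.map s.op h
    rwa [← Functor.map_comp_apply, ← op_comp, hs, op_id, Functor.map_id_apply] at h'
  · intro hf
    obtain ⟨d, g, e, rfl, hd⟩ := exists_factor_of_not_surjective f hf
    rw [op_comp, Functor.map_comp_apply]
    exact M.map g.op (hmin d _ hd)

include hy hmin in
/-- A dominant simplex is injective outside of the boundary. -/
lemma eq_of_map_eq_of_minimal (hdom : Dominant y) {c : GDelta} (f g : c ⟶ a)
    (h : L.map f.op y = L.map g.op y) (hf : L.map f.op y ∉ M.obj (op c)) : f = g := by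
  have hf' : Function.Surjective (vtx f) := by
    by_contra h'
    exact hf ((map_mem_iff_of_minimal hy hmin f).2 h')
  refine GDelta.hom_ext fun p => ?_
  -- Through a section `s` of `f` passing through `p`, the endomorphism `s ≫ g` fixes `y`. It is
  -- therefore invertible, and the identity by dominance; evaluating at the image of `p` gives the
  -- equality there.
  obtain ⟨s, hs, hsp⟩ := exists_section f hf' p
  have hy' : L.map (s ≫ g).op y = y := by
    rw [op_comp, Functor.map_comp_apply, ← h, ← Functor.map_comp_apply, ← op_comp, hs, op_id,
      Functor.map_id_apply]
  have hsg : Function.Surjective (vtx (s ≫ g)) := by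
    by_contra h'
    have := (map_mem_iff_of_minimal hy hmin (s ≫ g)).2 h'
    rw [hy'] at this
    exact hy this
  have := isIso_of_vtx_surjective (s ≫ g) hsg le_rfl
  have hid : s ≫ g = 𝟙 a := congrArg Iso.hom (hdom.2 (asIso (s ≫ g)) hy')
  have h' := congrArg (fun w : a ⟶ a => IsovHom.toFun w (IsovHom.toFun f p)) hid
  change IsovHom.toFun g (IsovHom.toFun s (IsovHom.toFun f p)) = IsovHom.toFun f p at h'
  rw [hsp] at h'
  exact h'.symm

include hy hmin in
/-- Attaching a dominant simplex whose boundary is in `M` attaches the cylinder on this simplex to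
the cylinder inclusion of `M` along that of its boundary. -/
lemma homOfLe_cylProdUnion_mem_of_minimal {W : MorphismProperty IsovSSet}
    [W.IsStableUnderCobaseChange] (hdom : Dominant y) (ε : Fin 2)
    (hW : W (cylProdUnion (boundary a) ε).ι) :
    W (Subfunctor.homOfLe (cylProdUnion_mono ε
      (le_sup_left : M ≤ M ⊔ Subfunctor.range (yonedaEquiv.symm y)))) := by
  let Y : stdSimplex a ⟶ L := yonedaEquiv.symm y
  have hY {c : GDeltaᵒᵖ} (f : c.unop ⟶ a) : Y.app c f = L.map f.op y := rfl
  have hpre : (cylProdUnion M ε).preimage (cylProd.map Y) = cylProdUnion (boundary a) ε := by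
    ext c ⟨(f : c.unop ⟶ a), χ⟩
    exact or_congr ((map_mem_iff_of_minimal hy hmin f).trans (mem_boundary_iff f).symm) Iff.rfl
  have hsup : cylProdUnion (M ⊔ Subfunctor.range Y) ε =
      cylProdUnion M ε ⊔ Subfunctor.range (cylProd.map Y) := by
    ext c ⟨x, χ⟩
    constructor
    · rintro ((h | ⟨f, rfl⟩) | h)
      · exact Or.inl (Or.inl h)
      · exact Or.inr ⟨(f, χ), rfl⟩
      · exact Or.inl (Or.inr h)
    · rintro ((h | h) | ⟨⟨f, χ'⟩, h⟩)
      · exact Or.inl (Or.inl h)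
      · exact Or.inr h
      · exact Or.inl (Or.inr ⟨f, congrArg Prod.fst h⟩)
  refine W.of_isPushout (isPushout_sup_range (cylProd.map Y) _ _ hsup ?_) (by rw [hpre]; exact hW)
  rintro c ⟨(f : c.unop ⟶ a), χ⟩ ⟨(g : c.unop ⟶ a), χ'⟩ h hf
  have h₁ : L.map f.op y = L.map g.op y := congrArg Prod.fst h
  have h₂ : χ = χ' := congrArg Prod.snd h
  rw [eq_of_map_eq_of_minimal hy hmin hdom f g h₁ (fun h => hf (Or.inl h)), h₂]

end Cell

lemma classC_le_of_classB_le {W : MorphismProperty IsovSSet} (hW : Saturated W)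
    (h : classB ≤ W) : classC ≤ W := by
  have := hW.retracts
  have := hW.pushouts
  have := hW.transfinite
  rintro _ _ _ @⟨K, L, i, hi, ε⟩
  refine (cylUnion_ι_mem_iff W i ε).2 ?_
  refine subfunctor_ι_mem_of_homOfLe_top _ ?_
  have htop : cylProdUnion (⊤ : Subfunctor L) ε = ⊤ :=
    top_le_iff.1 fun a x _ => Or.inl trivial
  have key := homOfLe_top_mem_of_step (fun M : Subfunctor L => cylProdUnion M ε)
    (cylProdUnion_mono ε) (fun ι _ m a x hx => ?_) W (Subfunctor.range i) (fun M hM hM' => ?_)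
  · revert key
    generalize_proofs h₁ h₂
    revert h₁
    rw [htop]
    exact fun _ h => h
  · rw [Subfunctor.iSup_obj, Set.mem_iUnion]
    rcases hx with hx | hx
    · rw [Subfunctor.iSup_obj, Set.mem_iUnion] at hx
      obtain ⟨j, hj⟩ := hx
      exact ⟨j, Or.inl hj⟩
    -- The end L × {ε} belongs to every stage, including the one at ⊥, so only unions of non-empty
    -- families are preserved.
    · exact ⟨Classical.arbitrary ι, Or.inr hx⟩
  · obtain ⟨a, y, hy, hmin⟩ := exists_minimal_simplex hM'
    have hnd := nondegenerate_of_minimal hy hmin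
    -- Every stage contains the image of `i`, so a simplex outside it falls under the normality of
    -- `i`.
    have hdom := (hi.2 a y hnd (fun h => hy (hM _ h))).dominant hnd
    refine ⟨M ⊔ Subfunctor.range (yonedaEquiv.symm y), ?_,
      homOfLe_cylProdUnion_mem_of_minimal hy hmin hdom ε ?_⟩
    · refine lt_of_le_of_ne le_sup_left fun h => hy ?_
      rw [h]
      exact Or.inr ⟨𝟙 a, L.map_id_apply (op a) y⟩
    · have := (cylUnion_ι_mem_iff W _ ε).1 (h _ (classB.mk a ε))
      rwa [Subfunctor.range_ι] at this

lemma saturation_le_saturation {S T : MorphismProperty IsovSSet}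
    (h : ∀ W : MorphismProperty IsovSSet, Saturated W → T ≤ W → S ≤ W) :
    saturation S ≤ saturation T :=
  fun _ _ _ hf W hW hT => hf W hW (h W hW hT)

end Isov

theorem mainTheorem4 :
    Isov.saturation Isov.classA = Isov.saturation Isov.classB ∧
      Isov.saturation Isov.classB = Isov.saturation Isov.classC ∧
      Isov.saturation Isov.classA = Isov.IsovariantAnodyne := by
  have hAB : Isov.saturation Isov.classA = Isov.saturation Isov.classB :=
    le_antisymm
      (Isov.saturation_le_saturation fun _ hW h =>
        Isov.classA_le_of_classC_le hW (Isov.classC_le_of_classB_le hW h))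
      (Isov.saturation_le_saturation fun _ hW h => Isov.classB_le_of_classA_le hW h)
  have hBC : Isov.saturation Isov.classB = Isov.saturation Isov.classC :=
    le_antisymm
      (Isov.saturation_le_saturation fun _ _ h => Isov.classB_le_of_classC_le h)
      (Isov.saturation_le_saturation fun _ hW h => Isov.classC_le_of_classB_le hW h)
  exact ⟨hAB, hBC, rfl⟩
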